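/- A cubic graph is a finite connected $3$-regular graph without loops or multiple edges, and its spectrum is the set of eigenvalues of its adjacency matrix. Call a closed set $K \subseteq [-3,3]$ spectral if there are arbitrarily large (equivalently, infinitely many non-isomorphic) cubic graphs whose spectrum is contained in $K$. Theorem. Let $K$ be a spectral set. Then: (i) The logarithmic capacity of $K$, regarded as a subset of $\mathbb{C}$, is at least $1$. Here the logarithmic capacity of a compact set $K \subset \mathbb{C}$ is $\sup_\mu \exp(-I(\mu))$, where $\mu$ ranges over the Borel probability measures on $K$ and $I(\mu) = \iint \log\frac{1}{|z-w|}\, d\mu(z)\, d\mu(w) \in (-\infty, +\infty]$. (ii) If $I$ is an interval contained in $(-1-\sqrt{2},\, 1+\sqrt{2})$ whose length is greater than $2$, then $I \cap K \neq \emptyset$. -/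

import Mathlib

open scoped ENNReal

noncomputable section

/-- The logarithmic kernel `log (1 / |z - w|)` on the plane, with values in `(-∞, +∞]`;
it is `+∞` exactly on the diagonal. -/
def logKernel (z w : ℂ) : EReal := -ENNReal.log (edist z w)

/-- The logarithmic energy `∬ log (1 / |z - w|) dμ(z) dμ(w)` of a measure on the plane, as the
integral of the positive part of the kernel minus the integral of its negative part. For a finite
measure of bounded support the negative part has a finite integral, so that the difference is a
well defined element of `(-∞, +∞]`. -/
def logEnergy (μ : MeasureTheory.Measure ℂ) : EReal :=
  ((∫⁻ z, ∫⁻ w, (logKernel z w).toENNReal ∂μ ∂μ : ℝ≥0∞) : EReal) -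
    ((∫⁻ z, ∫⁻ w, (-logKernel z w).toENNReal ∂μ ∂μ : ℝ≥0∞) : EReal)

/-- The logarithmic capacity of a set `E` in the plane: the supremum of `exp (-I(μ))`, where `I` is
the logarithmic energy, over all Borel probability measures `μ` carried by a compact subset
of `E`. -/
def logCapacity (E : Set ℂ) : ℝ≥0∞ :=
  ⨆ (μ : MeasureTheory.Measure ℂ) (_ : MeasureTheory.IsProbabilityMeasure μ)
    (_ : ∃ C : Set ℂ, IsCompact C ∧ C ⊆ E ∧ μ Cᶜ = 0), EReal.exp (-logEnergy μ)

open Classical in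
/-- A cubic graph: connected and `3`-regular (finite, without loops or multiple edges). -/
def IsCubicGraph {n : ℕ} (G : SimpleGraph (Fin n)) : Prop :=
  G.Connected ∧ G.IsRegularOfDegree 3

open Classical in
/-- The spectrum of the adjacency matrix of a finite graph. -/
def adjSpectrum {n : ℕ} (G : SimpleGraph (Fin n)) : Set ℝ :=
  spectrum ℝ (G.adjMatrix ℝ)

/-- A spectral set: a closed subset of `[-3, 3]` that contains the spectra of arbitrarily large
cubic graphs. -/
def IsSpectralSet (K : Set ℝ) : Prop :=
  IsClosed K ∧ K ⊆ Set.Icc (-3) 3 ∧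
    ∀ N : ℕ, ∃ n : ℕ, N ≤ n ∧ ∃ G : SimpleGraph (Fin n), IsCubicGraph G ∧ adjSpectrum G ⊆ K

end

/-! (i) The distinct eigenvalues of a graph are the roots of a squarefree monic integral polynomial,
so their discriminant is a nonzero integer and has absolute value at least 1. A connected cubic
graph with few distinct eigenvalues is small, so `K` contains arbitrarily large finite sets of this
kind. The uniform measures on these sets have a weak cluster point, whose energy is at most 0:
truncating the kernel at height `M` makes it continuous, and the diagonal then contributes only `M /
n` (`one_le_logCapacity`).

(ii) Let `c` be the midpoint of a segment of length `2r > 2` with ends in the interval, so `c ^ 2 ≤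
2`. If the spectrum avoids it, then `‖(A - c) f‖ ≥ r ‖f‖` for all `f`. Put on a path of `m` vertices
the values `w ^ i` with `|w| = 1` and `w + conj w = c`. Then `(A - c) f` vanishes along the path up
to boundary terms, and only the third neighbours of the path vertices receive mass. If those are
distinct, its norm is about `√m = ‖f‖`, a contradiction for large `m`. Path vertices `i < j` with
the same third neighbour do no harm when `Re (w ^ (j - i)) ≤ 0`.

On a geodesic `j - i` is 1 or 2, and `Re (w ^ 2) ≤ 0`, so only triangles (`j - i = 1`, `Re w = c /
2`) obstruct, and only for `c > 0`. For `c ≤ 1/2` the phase is changed across each triangle edge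
(`gap_le_of_le_half`). For `c ≥ 1/2` the path is rerouted through the apexes of triangles, so that
`j - i` is 2, 3 or exceptionally 4 (`detour_sub`). The exponent 4 is harmless for `c ≥ 4/5`; below
that, the configuration producing it carries its own test function (`not_gap_of_hexagon`). -/

/-- The adjacency operator of a finite graph on complex functions. -/
noncomputable def adjOp {V : Type*} [Fintype V] [DecidableEq V] (G : SimpleGraph V)
    [DecidableRel G.Adj] : EuclideanSpace ℂ V →ₗ[ℂ] EuclideanSpace ℂ V :=
  Matrix.toEuclideanLin (G.adjMatrix ℂ)

/-- The unit mass at a vertex. -/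
noncomputable def unitMass {V : Type*} [DecidableEq V] (v : V) : EuclideanSpace ℂ V :=
  EuclideanSpace.single v 1

/-! ### The adjacency operator and spectral gaps -/

section AdjOp

variable {V : Type*}

lemma unitMass_apply [DecidableEq V] (v x : V) : unitMass v x = if x = v then 1 else 0 := by
  simp [unitMass]

lemma inner_unitMass [Fintype V] [DecidableEq V] (v w : V) :
    inner ℂ (unitMass v) (unitMass w) = if v = w then (1 : ℂ) else 0 := by
  simp [unitMass, EuclideanSpace.inner_single_left]

lemma norm_unitMass [Fintype V] [DecidableEq V] (v : V) : ‖unitMass v‖ = 1 := by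
  simp [unitMass]

variable [Fintype V] [DecidableEq V] (G : SimpleGraph V) [DecidableRel G.Adj]

lemma adjOp_apply (f : EuclideanSpace ℂ V) (x : V) :
    adjOp G f x = ∑ y ∈ G.neighborFinset x, f y := by
  simp [adjOp, Matrix.toLpLin_apply, SimpleGraph.adjMatrix_mulVec_apply]

lemma adjOp_unitMass {v a b e : V} (h : ∀ x, G.Adj v x ↔ x = a ∨ x = b ∨ x = e)
    (hab : a ≠ b) (hae : a ≠ e) (hbe : b ≠ e) :
    adjOp G (unitMass v) = unitMass a + unitMass b + unitMass e := by
  ext x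
  rw [adjOp_apply]
  simp only [unitMass_apply, Finset.sum_ite_eq', SimpleGraph.mem_neighborFinset, PiLp.add_apply]
  simp only [show G.Adj x v ↔ x = a ∨ x = b ∨ x = e from by rw [G.adj_comm, h]]
  by_cases h1 : x = a
  · subst h1; simp [hab, hae]
  · by_cases h2 : x = b
    · subst h2; simp [h1, hbe]
    · simp [h1, h2]

/-- A spectral gap around `c` bounds the quadratic form of `(A - c) ^ 2` from below. -/
lemma le_sum_sq_of_gap {c r : ℝ} (hr : 0 ≤ r)
    (h : ∀ l ∈ spectrum ℝ (G.adjMatrix ℝ), r ≤ |l - c|) (g : V → ℝ) :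
    r ^ 2 * ∑ x, g x ^ 2 ≤ ∑ x, (∑ y ∈ G.neighborFinset x, g y - c * g x) ^ 2 := by
  have hA : (G.adjMatrix ℝ).IsHermitian := G.isHermitian_adjMatrix ℝ
  set T := Matrix.toEuclideanLin (G.adjMatrix ℝ) with hT
  have hTs : T.IsSymmetric := Matrix.isSymmetric_toEuclideanLin_iff.mpr hA
  let b := hA.eigenvectorBasis
  let u : EuclideanSpace ℝ V := WithLp.toLp 2 g
  have e1 : ∑ x, g x ^ 2 = ‖u‖ ^ 2 := by
    rw [EuclideanSpace.norm_sq_eq]; simp [u]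
  have e2 : ∑ x, (∑ y ∈ G.neighborFinset x, g y - c * g x) ^ 2 = ‖T u - c • u‖ ^ 2 := by
    rw [EuclideanSpace.norm_sq_eq]
    simp [u, hT, Matrix.toLpLin_apply, SimpleGraph.adjMatrix_mulVec_apply]
  rw [e1, e2, ← b.sum_sq_norm_inner_right u, ← b.sum_sq_norm_inner_right (T u - c • u),
    Finset.mul_sum]
  refine Finset.sum_le_sum fun i _ => ?_
  have hb : T (b i) = hA.eigenvalues i • b i := by
    rw [hT, Matrix.toLpLin_apply, hA.mulVec_eigenvectorBasis i]; rfl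
  have : inner ℝ (b i) (T u - c • u) = (hA.eigenvalues i - c) * inner ℝ (b i) u := by
    rw [inner_sub_right, ← hTs, hb, inner_smul_left, inner_smul_right]; simp; ring
  rw [this, norm_mul, mul_pow]
  have hl := h _ (hA.eigenvalues_mem_spectrum_real i)
  have : r ^ 2 ≤ ‖hA.eigenvalues i - c‖ ^ 2 := pow_le_pow_left₀ hr hl 2
  exact mul_le_mul_of_nonneg_right this (by positivity)

/-- Since `A` and `c` are real, the real and imaginary parts of `f` can be treated separately. -/
lemma le_norm_adjOp_sub {c r : ℝ} (hr : 0 ≤ r)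
    (h : ∀ l ∈ spectrum ℝ (G.adjMatrix ℝ), r ≤ |l - c|) (f : EuclideanSpace ℂ V) :
    r * ‖f‖ ≤ ‖adjOp G f - (c : ℂ) • f‖ := by
  refine le_of_sq_le_sq ?_ (norm_nonneg _)
  have h1 := le_sum_sq_of_gap G hr h fun x => (f x).re
  have h2 := le_sum_sq_of_gap G hr h fun x => (f x).im
  rw [mul_pow, EuclideanSpace.norm_sq_eq, EuclideanSpace.norm_sq_eq]
  have e1 : ∑ x, ‖f x‖ ^ 2 = ∑ x, (f x).re ^ 2 + ∑ x, (f x).im ^ 2 := by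
    rw [← Finset.sum_add_distrib]
    refine Finset.sum_congr rfl fun x _ => ?_
    rw [Complex.sq_norm, Complex.normSq_apply]; ring
  have e2 : ∑ x, ‖(adjOp G f - (c : ℂ) • f) x‖ ^ 2 =
      ∑ x, (∑ y ∈ G.neighborFinset x, (f y).re - c * (f x).re) ^ 2 +
      ∑ x, (∑ y ∈ G.neighborFinset x, (f y).im - c * (f x).im) ^ 2 := by
    rw [← Finset.sum_add_distrib]
    refine Finset.sum_congr rfl fun x _ => ?_
    rw [Complex.sq_norm, Complex.normSq_apply, PiLp.sub_apply, adjOp_apply]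
    simp
    ring
  rw [e1, e2]
  linarith

end AdjOp

/-! ### Test functions on paths -/

section PathEnergy

lemma norm_sum_sq_le_of_inner_nonpos {E : Type*} [NormedAddCommGroup E] [InnerProductSpace ℂ E]
    (v : ℕ → E) (m : ℕ) (h : ∀ i j, i < j → j < m → (inner ℂ (v i) (v j)).re ≤ 0) :
    ‖∑ i ∈ Finset.range m, v i‖ ^ 2 ≤ ∑ i ∈ Finset.range m, ‖v i‖ ^ 2 := by
  induction m with
  | zero => simp
  | succ m ih =>
    rw [Finset.sum_range_succ, Finset.sum_range_succ, @norm_add_sq ℂ, sum_inner]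
    have h1 := ih fun i j hij hj => h i j hij (by omega)
    have h2 : (∑ i ∈ Finset.range m, inner ℂ (v i) (v m)).re ≤ 0 := by
      rw [Complex.re_sum]
      exact Finset.sum_nonpos fun i hi => h i m (Finset.mem_range.mp hi) (by omega)
    simp only [RCLike.re_to_complex]
    linarith

variable {V : Type*} [Fintype V] [DecidableEq V] (G : SimpleGraph V) [DecidableRel G.Adj]

/-- On a path every vertex has two neighbours on the path and one further neighbour; a solution
of a three term recurrence is carried to the contributions of the latter, up to two boundary
terms. -/
lemma adjOp_sub_path_sum (q s : ℕ → V) (a r : ℕ → ℂ) (c : ℂ) (m : ℕ)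
    (hq : ∀ i < m, adjOp G (unitMass (q (i + 1))) =
      unitMass (q i) + unitMass (q (i + 2)) + unitMass (s (i + 1)))
    (hr : ∀ i < m, a i + a (i + 2) - c * a (i + 1) = r (i + 1)) :
    adjOp G (∑ i ∈ Finset.range m, a (i + 1) • unitMass (q (i + 1))) -
        c • ∑ i ∈ Finset.range m, a (i + 1) • unitMass (q (i + 1)) =
      ∑ i ∈ Finset.range m, (r (i + 1) • unitMass (q (i + 1)) + a (i + 1) • unitMass (s (i + 1))) +
      ((a 1 • unitMass (q 0) - a 0 • unitMass (q 1)) +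
        (a m • unitMass (q (m + 1)) - a (m + 1) • unitMass (q m))) := by
  induction m with
  | zero => simp
  | succ m ih =>
    have ih' := ih (fun i hi => hq i (by omega)) (fun i hi => hr i (by omega))
    rw [Finset.sum_range_succ, Finset.sum_range_succ, map_add, map_smul, hq m (by omega),
      ← hr m (by omega)]
    rw [sub_eq_iff_eq_add] at ih'
    rw [ih']
    module

/-- The test function `∑ a i • unitMass (q i)` has norm exactly `√m`, and the four boundary terms of
its image are unit vectors, whence the 4. For `r > 1` and fixed `C` the conclusion fails at some
`m`, by `exists_sqrt_add_lt`. -/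
lemma gap_le_of_path {c r : ℝ} (hr : 0 ≤ r)
    (hgap : ∀ l ∈ spectrum ℝ (G.adjMatrix ℝ), r ≤ |l - c|)
    (q s : ℕ → V) (a d : ℕ → ℂ) (m : ℕ) (C : ℝ)
    (hq : ∀ i < m, adjOp G (unitMass (q (i + 1))) =
      unitMass (q i) + unitMass (q (i + 2)) + unitMass (s (i + 1)))
    (hd : ∀ i < m, a i + a (i + 2) - c * a (i + 1) = d (i + 1))
    (ha : ∀ i, ‖a i‖ = 1)
    (hinj : ∀ i j, i < j → j < m → q (i + 1) ≠ q (j + 1))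
    (hS : ‖∑ i ∈ Finset.range m,
      (d (i + 1) • unitMass (q (i + 1)) + a (i + 1) • unitMass (s (i + 1)))‖ ^ 2 ≤ m + C) :
    r * √m ≤ √(m + C) + 4 := by
  set f := ∑ i ∈ Finset.range m, a (i + 1) • unitMass (q (i + 1)) with hf
  have hfn : ‖f‖ = √m := by
    rw [eq_comm, Real.sqrt_eq_iff_mul_self_eq (by positivity) (by positivity), ← sq]
    have : ((‖f‖ ^ 2 : ℝ) : ℂ) = m := by
      push_cast
      rw [show (‖f‖ : ℂ) ^ 2 = inner ℂ f f from (inner_self_eq_norm_sq_to_K (𝕜 := ℂ) f).symm]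
      nth_rw 1 [hf]
      rw [sum_inner]
      have : ∀ i ∈ Finset.range m, inner ℂ (a (i + 1) • unitMass (q (i + 1))) f = 1 := by
        intro i hi
        rw [hf, inner_sum, Finset.sum_eq_single_of_mem i hi]
        · rw [inner_smul_left, inner_smul_right, inner_unitMass]
          simp [Complex.conj_mul', ha]
        · intro j hj hji
          rw [inner_smul_left, inner_smul_right, inner_unitMass, if_neg]
          · simp
          · rcases lt_or_gt_of_ne hji with h | h
            · exact (hinj j i h (Finset.mem_range.mp hi)).symm
            · exact hinj i j h (Finset.mem_range.mp hj)
      rw [Finset.sum_congr rfl this]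
      simp
    exact_mod_cast this.symm
  have h1 := le_norm_adjOp_sub G hr hgap f
  rw [hf, adjOp_sub_path_sum G q s a d c m hq hd, ← hf, hfn] at h1
  refine h1.trans ((norm_add_le _ _).trans (add_le_add (Real.le_sqrt_of_sq_le hS) ?_))
  have hn : ∀ i v, ‖a i • unitMass (V := V) v‖ = 1 := fun i v => by
    rw [norm_smul, ha, norm_unitMass, one_mul]
  refine (norm_add_le _ _).trans ((add_le_add (norm_sub_le _ _) (norm_sub_le _ _)).trans ?_)
  rw [hn, hn, hn, hn]
  norm_num

lemma exists_sqrt_add_lt {r : ℝ} (hr : 1 < r) (C : ℝ) :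
    ∃ m : ℕ, 2 ≤ m ∧ √(m + C) + 4 < r * √m := by
  obtain ⟨m, hm⟩ := exists_nat_gt (((|C| + 5) / (r - 1)) ^ 2 + 2)
  have hm2 : (2 : ℝ) ≤ m := by nlinarith [sq_nonneg ((|C| + 5) / (r - 1))]
  refine ⟨m, by exact_mod_cast hm2, ?_⟩
  have h0 : 0 < r - 1 := by linarith
  have h1 : 1 ≤ √m := Real.one_le_sqrt.mpr (by linarith)
  have h2 : (|C| + 5) / (r - 1) < √m := Real.lt_sqrt_of_sq_lt (by linarith)
  rw [div_lt_iff₀ h0] at h2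
  have h3 : √(m + C) ≤ √m + |C| := by
    refine Real.sqrt_le_iff.mpr ⟨by positivity, ?_⟩
    have := Real.sq_sqrt (show (0 : ℝ) ≤ m by positivity)
    nlinarith [abs_nonneg C, le_abs_self C, sq_nonneg |C|]
  nlinarith

end PathEnergy

/-! ### Geodesics in cubic graphs -/

section Geodesic

/-- A geodesic `p 0, …, p L` in a cubic graph, where `e k` is the third neighbour of the inner
vertex `p k`. -/
structure IsCubicGeodesic {V : Type*} (G : SimpleGraph V) (p e : ℕ → V) (L : ℕ) : Prop where
  le_add_length : ∀ i j, i ≤ L → j ≤ L → ∀ w : G.Walk (p i) (p j), j ≤ i + w.length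
  adj_iff : ∀ k, k + 2 ≤ L → ∀ x, G.Adj (p (k + 1)) x ↔ x = p k ∨ x = p (k + 2) ∨ x = e (k + 1)
  ne_left : ∀ k, k + 2 ≤ L → p k ≠ e (k + 1)
  ne_right : ∀ k, k + 2 ≤ L → p (k + 2) ≠ e (k + 1)

variable {V : Type*} {G : SimpleGraph V}

/-- At most `d ^ j` vertices are ends of walks of length `j` from `u`, so walks shorter than `L`
cannot reach every vertex. -/
lemma SimpleGraph.IsRegularOfDegree.exists_far [Fintype V] [DecidableEq V] [DecidableRel G.Adj]
    {d : ℕ} (hG : G.IsRegularOfDegree d) (u : V) (L : ℕ)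
    (hL : ∑ j ∈ Finset.range L, d ^ j < Fintype.card V) :
    ∃ v, ∀ w : G.Walk u v, L ≤ w.length := by
  let S : ℕ → Finset V := fun j => Nat.rec {u} (fun _ s => s.biUnion fun x => G.neighborFinset x) j
  have hS : ∀ j, (S j).card ≤ d ^ j := by
    intro j
    induction j with
    | zero => simp [S]
    | succ j ih =>
      calc (S (j + 1)).card ≤ ∑ x ∈ S j, (G.neighborFinset x).card := Finset.card_biUnion_le
        _ = (S j).card * d := by
          rw [Finset.sum_congr rfl fun x _ => (G.card_neighborFinset_eq_degree x).trans (hG x)]; simp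
        _ ≤ d ^ (j + 1) := by rw [pow_succ]; exact Nat.mul_le_mul_right d ih
  have hw : ∀ j v (w : G.Walk u v), w.length = j → v ∈ S j := by
    intro j
    induction j with
    | zero => intro v w hw; simp [S, (SimpleGraph.Walk.eq_of_length_eq_zero hw).symm]
    | succ j ih =>
      intro v w hw
      have hnn : ¬ w.Nil := by
        rw [← SimpleGraph.Walk.length_eq_zero_iff]; omega
      refine Finset.mem_biUnion.mpr ⟨w.penultimate, ih _ w.dropLast ?_, ?_⟩
      · rw [SimpleGraph.Walk.length_dropLast]; omega
      · rw [SimpleGraph.mem_neighborFinset]; exact w.adj_penultimate hnn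
  have hc : ((Finset.range L).biUnion S).card < Fintype.card V :=
    (Finset.card_biUnion_le.trans (Finset.sum_le_sum fun j _ => hS j)).trans_lt hL
  obtain ⟨v, hv⟩ : ∃ v, v ∉ (Finset.range L).biUnion S := by
    by_contra! hcon
    rw [Finset.eq_univ_of_forall hcon, Finset.card_univ] at hc
    exact lt_irrefl _ hc
  refine ⟨v, fun w => ?_⟩
  by_contra! hlt
  exact hv (Finset.mem_biUnion.mpr ⟨w.length, Finset.mem_range.mpr hlt, hw _ v w rfl⟩)

lemma exists_third_neighbor [Fintype V] [DecidableEq V] [DecidableRel G.Adj]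
    (hG : G.IsRegularOfDegree 3) {v a b : V} (ha : G.Adj v a) (hb : G.Adj v b) (hab : a ≠ b) :
    ∃ e, (∀ x, G.Adj v x ↔ x = a ∨ x = b ∨ x = e) ∧ a ≠ e ∧ b ≠ e := by
  have h3 : (((G.neighborFinset v).erase a).erase b).card = 1 := by
    rw [Finset.card_erase_of_mem, Finset.card_erase_of_mem,
      SimpleGraph.card_neighborFinset_eq_degree, hG v]
    · simpa using ha
    · simpa [hab.symm] using hb
  obtain ⟨e, he⟩ := Finset.card_eq_one.mp h3
  have hmem : ∀ x, (x ≠ b ∧ x ≠ a ∧ G.Adj v x) ↔ x = e := fun x => by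
    rw [← Finset.mem_singleton, ← he]; simp
  have hee := (hmem e).mpr rfl
  refine ⟨e, fun x => ⟨fun hx => ?_, ?_⟩, hee.2.1.symm, hee.1.symm⟩
  · by_cases h1 : x = a
    · exact Or.inl h1
    · by_cases h2 : x = b
      · exact Or.inr (Or.inl h2)
      · exact Or.inr (Or.inr ((hmem x).mp ⟨h2, h1, hx⟩))
  · rintro (rfl | rfl | rfl)
    exacts [ha, hb, hee.2.2]

lemma exists_isCubicGeodesic [Fintype V] [DecidableEq V] [DecidableRel G.Adj]
    (hG : G.IsRegularOfDegree 3) (hc : G.Connected) (L : ℕ)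
    (hL : ∑ j ∈ Finset.range L, 3 ^ j < Fintype.card V) :
    ∃ p e : ℕ → V, IsCubicGeodesic G p e L := by
  obtain ⟨u⟩ := hc.nonempty
  obtain ⟨v, hv⟩ := hG.exists_far u L hL
  obtain ⟨w, hw⟩ := hc.exists_walk_length_eq_dist u v
  let p := w.getVert
  have hwL : L ≤ w.length := hv w
  have hlen : ∀ i j, i ≤ L → j ≤ L → ∀ t : G.Walk (p i) (p j), j ≤ i + t.length := by
    intro i j hi hj t
    -- Replacing the segment of `w` between `p i` and `p j` by `t` cannot shorten the shortest walk
    -- `w`.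
    have := SimpleGraph.dist_le ((w.take i).append (t.append (w.drop j)))
    rw [← hw] at this
    simp only [SimpleGraph.Walk.length_append, SimpleGraph.Walk.take_length,
      SimpleGraph.Walk.drop_length] at this
    omega
  have hadj : ∀ k, k < L → G.Adj (p k) (p (k + 1)) := fun k hk =>
    w.adj_getVert_succ (by omega)
  have hne : ∀ k, k + 2 ≤ L → p k ≠ p (k + 2) := fun k hk h => by
    have := hlen k (k + 2) (by omega) hk (SimpleGraph.Walk.nil.copy rfl h)
    simp at this
  have hex : ∀ k, ∃ e, k + 2 ≤ L → (∀ x, G.Adj (p (k + 1)) x ↔ x = p k ∨ x = p (k + 2) ∨ x = e) ∧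
      p k ≠ e ∧ p (k + 2) ≠ e := fun k => by
    by_cases hk : k + 2 ≤ L
    · obtain ⟨e, he⟩ := exists_third_neighbor hG (hadj k (by omega)).symm (hadj (k + 1) (by omega))
        (hne k hk)
      exact ⟨e, fun _ => he⟩
    · exact ⟨u, fun h => absurd h hk⟩
  choose e he using hex
  -- The chosen `e k` belongs to `p (k + 1)`, hence the shift.
  exact ⟨p, fun k => e (k - 1), hlen, fun k hk => (he k hk).1, fun k hk => (he k hk).2.1,
    fun k hk => (he k hk).2.2⟩

namespace IsCubicGeodesic

variable {p e : ℕ → V} {L : ℕ} (h : IsCubicGeodesic G p e L)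
include h

lemma adj_third {k : ℕ} (h1 : 1 ≤ k) (hk : k < L) : G.Adj (p k) (e k) := by
  obtain ⟨k, rfl⟩ := Nat.exists_eq_add_of_le' h1
  exact (h.adj_iff k (by omega) _).mpr (by simp)

lemma adj_succ {k : ℕ} (h1 : 1 ≤ k) (hk : k < L) : G.Adj (p k) (p (k + 1)) := by
  obtain ⟨k, rfl⟩ := Nat.exists_eq_add_of_le' h1
  exact (h.adj_iff k (by omega) _).mpr (by simp)

lemma index_le_of_eq {i j : ℕ} (hi : i ≤ L) (hj : j ≤ L) (hij : p i = p j) : j ≤ i := by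
  simpa using h.le_add_length i j hi hj (SimpleGraph.Walk.nil.copy rfl hij)

lemma index_eq {i j : ℕ} (hi : i ≤ L) (hj : j ≤ L) (hij : p i = p j) : i = j :=
  le_antisymm (h.index_le_of_eq hj hi hij.symm) (h.index_le_of_eq hi hj hij)

lemma index_le_add_one {i j : ℕ} (hi : i ≤ L) (hj : j ≤ L) (hij : G.Adj (p i) (p j)) :
    j ≤ i + 1 := by
  simpa using h.le_add_length i j hi hj hij.toWalk

lemma index_le_add_two {i j : ℕ} (hi : i ≤ L) (hj : j ≤ L) {x : V} (hx : G.Adj (p i) x)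
    (hx' : G.Adj x (p j)) : j ≤ i + 2 := by
  simpa using h.le_add_length i j hi hj (.cons hx (.cons hx' .nil))

lemma index_le_add_three {i j : ℕ} (hi : i ≤ L) (hj : j ≤ L) {x y : V} (hx : G.Adj (p i) x)
    (hxy : G.Adj x y) (hy : G.Adj y (p j)) : j ≤ i + 3 := by
  simpa using h.le_add_length i j hi hj (.cons hx (.cons hxy (.cons hy .nil)))

lemma index_le_add_four {i j : ℕ} (hi : i ≤ L) (hj : j ≤ L) {x y z : V} (hx : G.Adj (p i) x)
    (hxy : G.Adj x y) (hyz : G.Adj y z) (hz : G.Adj z (p j)) : j ≤ i + 4 := by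
  simpa using h.le_add_length i j hi hj (.cons hx (.cons hxy (.cons hyz (.cons hz .nil))))

/-- A neighbour of `p k` on the geodesic has index `k - 1` or `k + 1`, and these two are not the
third neighbour. -/
lemma third_ne {k i : ℕ} (h1 : 1 ≤ k) (hk : k < L) (hi : i ≤ L) : e k ≠ p i := by
  intro hki
  have ha := h.adj_third h1 hk
  rw [hki] at ha
  have h2 := h.index_le_add_one hk.le hi ha
  have h3 := h.index_le_add_one hi hk.le ha.symm
  obtain ⟨k, rfl⟩ := Nat.exists_eq_add_of_le' h1
  have h4 : i ≠ k + 1 := fun hh => by rw [hh] at ha; exact G.irrefl ha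
  rcases (by omega : i = k ∨ i = k + 2) with rfl | rfl
  · exact h.ne_left i (by omega) hki.symm
  · exact h.ne_right k (by omega) hki.symm

lemma index_le_of_third_eq {i j : ℕ} (hi : 1 ≤ i) (hi' : i < L) (hj : 1 ≤ j) (hj' : j < L)
    (hij : e i = e j) : j ≤ i + 2 :=
  h.index_le_add_two hi'.le hj'.le (h.adj_third hi hi') (hij ▸ (h.adj_third hj hj').symm)

lemma eq_third {k : ℕ} (h1 : 1 ≤ k) (hk : k < L) {x : V} (hx : G.Adj (p k) x)
    (hl : x ≠ p (k - 1)) (hr : x ≠ p (k + 1)) : x = e k := by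
  obtain ⟨k, rfl⟩ := Nat.exists_eq_add_of_le' h1
  rcases (h.adj_iff k (by omega) x).mp hx with h | h | h
  · exact absurd h hl
  · exact absurd h hr
  · exact h

end IsCubicGeodesic

end Geodesic

/-! ### The cases `c ≤ 0` and `0 ≤ c ≤ 1/2`: test functions on the geodesic itself -/

section Regimes

open ComplexConjugate

lemma exists_unit_add_conj_eq {c : ℝ} (hc : |c| ≤ 2) : ∃ w : ℂ, ‖w‖ = 1 ∧ w + conj w = c := by
  refine ⟨⟨c / 2, √(1 - (c / 2) ^ 2)⟩, ?_, ?_⟩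
  · have h : 0 ≤ 1 - (c / 2) ^ 2 := by
      have := sq_le_sq' (abs_le.mp hc).1 (abs_le.mp hc).2
      nlinarith
    rw [← sq_eq_sq₀ (norm_nonneg _) zero_le_one, Complex.sq_norm, Complex.normSq_apply,
      Real.mul_self_sqrt h]
    ring
  · apply Complex.ext <;> simp

lemma re_of_add_conj_eq {c : ℝ} {w : ℂ} (hc : w + conj w = c) : w.re = c / 2 := by
  have := congrArg Complex.re hc
  simp at this
  linarith

lemma conj_mul_self_of_norm_eq_one {w : ℂ} (hw : ‖w‖ = 1) : conj w * w = 1 := by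
  rw [Complex.conj_mul', hw]; simp

section UnitPowers

variable {c : ℝ} {w : ℂ} (hw : ‖w‖ = 1) (hc : w + conj w = c)
include hw hc

lemma sq_eq_of_unit : w ^ 2 = c * w - 1 := by
  rw [← hc, add_mul, conj_mul_self_of_norm_eq_one hw]; ring

lemma re_sq_of_unit : (w ^ 2).re = (c ^ 2 - 2) / 2 := by
  rw [sq_eq_of_unit hw hc]
  simp [re_of_add_conj_eq hc]
  ring

lemma re_pow_three_of_unit : (w ^ 3).re = (c ^ 3 - 3 * c) / 2 := by
  have : w ^ 3 = ((c ^ 2 - 1 : ℝ) : ℂ) * w - (c : ℝ) := by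
    push_cast; linear_combination (w + c) * sq_eq_of_unit hw hc
  rw [this, Complex.sub_re, Complex.re_ofReal_mul, re_of_add_conj_eq hc, Complex.ofReal_re]
  ring

lemma re_pow_four_of_unit : (w ^ 4).re = (c ^ 4 - 4 * c ^ 2 + 2) / 2 := by
  have : w ^ 4 = ((c ^ 3 - 2 * c : ℝ) : ℂ) * w - ((c ^ 2 - 1 : ℝ) : ℂ) := by
    push_cast; linear_combination (w ^ 2 + c * w + (c ^ 2 - 1)) * sq_eq_of_unit hw hc
  rw [this, Complex.sub_re, Complex.re_ofReal_mul, re_of_add_conj_eq hc, Complex.ofReal_re]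
  ring

end UnitPowers

variable {V : Type*} [Fintype V] [DecidableEq V] {G : SimpleGraph V} [DecidableRel G.Adj]

/-- The powers of `w` solve the recurrence without defect, so the image consists of masses at the
vertices `s i`; `hs` makes all their cross terms nonpositive. -/
lemma gap_le_of_path_pow {c r : ℝ} (hr : 0 ≤ r)
    (hgap : ∀ l ∈ spectrum ℝ (G.adjMatrix ℝ), r ≤ |l - c|) {w : ℂ} (hw : ‖w‖ = 1)
    (hc : w + conj w = c) (q s : ℕ → V) (m : ℕ)
    (hq : ∀ i < m, adjOp G (unitMass (q (i + 1))) =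
      unitMass (q i) + unitMass (q (i + 2)) + unitMass (s (i + 1)))
    (hinj : ∀ i j, i < j → j < m → q (i + 1) ≠ q (j + 1))
    (hs : ∀ i j, i < j → j < m → s (i + 1) = s (j + 1) → (w ^ (j - i)).re ≤ 0) :
    r * √m ≤ √(m + 0) + 4 := by
  refine gap_le_of_path G hr hgap q s (fun i => w ^ i) (fun _ => 0) m 0 hq ?_ (by simp [hw]) hinj ?_
  · intro i _
    linear_combination w ^ i * sq_eq_of_unit hw hc
  · simp only [zero_smul, zero_add, add_zero]
    refine (norm_sum_sq_le_of_inner_nonpos _ m ?_).trans ?_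
    · intro i j hij hj
      rw [inner_smul_left, inner_smul_right, inner_unitMass]
      split_ifs with h
      · obtain ⟨n, rfl⟩ := Nat.exists_eq_add_of_lt hij
        have h1 := hs _ _ hij hj h
        have h2 : conj (w ^ (i + 1)) * (w ^ (i + n + 1 + 1) * 1) = w ^ (i + n + 1 - i) := by
          rw [show i + n + 1 - i = n + 1 by omega, show i + n + 1 + 1 = (i + 1) + (n + 1) by ring,
            pow_add w (i + 1), map_pow, mul_one, ← mul_assoc, ← mul_pow,
            conj_mul_self_of_norm_eq_one hw, one_pow, one_mul]
        rw [h2]; exact h1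
      · simp
    · simp [norm_smul, hw, norm_unitMass]

namespace IsCubicGeodesic

variable {p e : ℕ → V} {L : ℕ} (h : IsCubicGeodesic G p e L)
include h

lemma adjOp_unitMass_inner {k : ℕ} (hk : k + 2 ≤ L) : adjOp G (unitMass (p (k + 1))) =
    unitMass (p k) + unitMass (p (k + 2)) + unitMass (e (k + 1)) :=
  adjOp_unitMass G (h.adj_iff k hk)
    (fun hh => by have := h.index_eq (by omega) hk hh; omega) (h.ne_left k hk) (h.ne_right k hk)

lemma gap_le_of_nonpos {c r : ℝ} (hr : 0 ≤ r)
    (hgap : ∀ l ∈ spectrum ℝ (G.adjMatrix ℝ), r ≤ |l - c|) (hc0 : c ≤ 0) (hc2 : c ^ 2 ≤ 2)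
    {m : ℕ} (hm : m + 1 ≤ L) : r * √m ≤ √(m + 0) + 4 := by
  obtain ⟨w, hw, hc⟩ := exists_unit_add_conj_eq (c := c) (abs_le_of_sq_le_sq (by linarith) two_pos.le)
  refine gap_le_of_path_pow hr hgap hw hc p e m (fun i hi => h.adjOp_unitMass_inner (by omega))
    (fun i j hij hj hh => ?_) (fun i j hij hj hh => ?_)
  · have := h.index_eq (by omega) (by omega) hh
    omega
  · have := h.index_le_of_third_eq (by omega) (by omega) (by omega) (by omega) hh
    rcases (by omega : j = i + 1 ∨ j = i + 2) with rfl | rfl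
    · rw [show i + 1 - i = 1 by omega, pow_one, re_of_add_conj_eq hc]; linarith
    · rw [show i + 2 - i = 2 by omega, re_sq_of_unit hw hc]; linarith

end IsCubicGeodesic

lemma inner_pair_of_ne {x y x' y' : V} (d a d' a' : ℂ) (h1 : x ≠ x') (h2 : x ≠ y') (h3 : y ≠ x') :
    inner ℂ (d • unitMass x + a • unitMass y) (d' • unitMass x' + a' • unitMass y') =
      if y = y' then conj a * a' else 0 := by
  simp [inner_unitMass, h1, h2, h3, mul_comm]

lemma norm_sq_pair_of_ne {x y : V} (d a : ℂ) (hxy : x ≠ y) :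
    ‖d • unitMass x + a • unitMass y‖ ^ 2 = ‖d‖ ^ 2 + ‖a‖ ^ 2 := by
  rw [@norm_add_sq ℂ, inner_smul_left, inner_smul_right, inner_unitMass, if_neg hxy]
  simp [norm_smul, norm_unitMass]

namespace IsCubicGeodesic

variable {p e : ℕ → V} {L : ℕ} (h : IsCubicGeodesic G p e L)
include h

/-- Across a triangle edge the phase advances by `-conj w`, with real part `-c / 2 ≤ 0`. This costs
a defect of size `c` in the recurrence at both ends of the edge, that is `2 c ^ 2` in the squared
norm, and gains `c` from the cross term at the apex. The balance `2 c ^ 2 ≤ c` is where `c ≤ 1/2` is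
used. -/
lemma gap_le_of_le_half {c r : ℝ} (hr : 0 ≤ r)
    (hgap : ∀ l ∈ spectrum ℝ (G.adjMatrix ℝ), r ≤ |l - c|) (hc0 : 0 ≤ c) (hc2 : c ≤ 1 / 2)
    {m : ℕ} (hm : m + 3 ≤ L) : r * √(m + 2 : ℕ) ≤ √((m + 2 : ℕ) + 9) + 4 := by
  have hcsq : c ^ 2 ≤ 1 / 4 := by nlinarith
  obtain ⟨w, hw, hc⟩ := exists_unit_add_conj_eq (c := c) (abs_le_of_sq_le_sq (by nlinarith) two_pos.le)
  have hww := conj_mul_self_of_norm_eq_one hw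
  -- `t` marks triangle edges, `u` is the phase step and `d` the defect. The structure does not
  -- constrain `e 0`; it affects only a global phase and the defect at the first vertex.
  let t : ℕ → ℝ := fun k => if e k = e (k + 1) then 1 else 0
  let u : ℕ → ℂ := fun k => if e k = e (k + 1) then -conj w else w
  let a : ℕ → ℂ := fun k => ∏ j ∈ Finset.range k, u j
  let d : ℕ → ℂ := fun k => -(c * (t (k - 1) + t k) : ℝ) * a k
  have hu : ∀ k, ‖u k‖ = 1 := fun k => by simp only [u]; split_ifs <;> simp [hw]
  have ha : ∀ k, ‖a k‖ = 1 := fun k => by simp [a, hu]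
  have hasucc : ∀ k, a (k + 1) = a k * u k := fun k => Finset.prod_range_succ u k
  have hau : ∀ k, conj (a k) * a k = 1 := fun k => by rw [Complex.conj_mul', ha]; simp
  have huu : ∀ k, conj (u k) * u k = 1 := fun k => by rw [Complex.conj_mul', hu]; simp
  have hure : ∀ k, e k = e (k + 1) → (u k).re = - c / 2 := fun k hk => by
    simp [u, hk, re_of_add_conj_eq hc]; ring
  have ht : ∀ k, t k = 0 ∨ t k = 1 := fun k => by simp only [t]; split_ifs <;> simp
  have hd1 : ∀ k, conj (u k) + u (k + 1) - c = -(c * (t k + t (k + 1)) : ℝ) := fun k => by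
    simp only [u, t, ← hc]
    push_cast [← hc]
    split_ifs <;> simp <;> ring
  let v : ℕ → EuclideanSpace ℂ V := fun i =>
    d (i + 1) • unitMass (p (i + 1)) + a (i + 1) • unitMass (e (i + 1))
  have hvn : ∀ i, i + 2 ≤ L → ‖v i‖ ^ 2 = c ^ 2 * (t i + t (i + 1)) ^ 2 + 1 := fun i hi => by
    simp only [v]
    rw [norm_sq_pair_of_ne _ _ (h.third_ne (by omega) (by omega) (by omega)).symm, ha]
    simp only [d, norm_mul, ha, norm_neg, Complex.norm_real, mul_one, one_pow, Real.norm_eq_abs,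
      Nat.add_sub_cancel, mul_pow, sq_abs]
  have hvi : ∀ i j, i < j → j + 2 ≤ L → inner ℂ (v i) (v j) =
      if e (i + 1) = e (j + 1) then conj (a (i + 1)) * a (j + 1) else 0 := fun i j hij hj => by
    refine inner_pair_of_ne _ _ _ _ (fun hh => ?_)
      (h.third_ne (by omega) (by omega) (by omega)).symm
      (h.third_ne (by omega) (by omega) (by omega))
    have := h.index_eq (by omega) (by omega) hh
    omega
  have hvfar : ∀ i j, i + 2 < j → j + 2 ≤ L → inner ℂ (v i) (v j) = 0 := fun i j hij hj => by
    rw [hvi i j (by omega) hj, if_neg]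
    intro hh
    have := h.index_le_of_third_eq (by omega) (by omega) (by omega) (by omega) hh
    omega
  have hv1 : ∀ i, i + 3 ≤ L → (inner ℂ (v i) (v (i + 1))).re = - c / 2 * t (i + 1) := fun i hi => by
    rw [hvi i _ (by omega) (by omega)]
    simp only [t]
    split_ifs with hh
    · rw [hasucc (i + 1), ← mul_assoc, hau, one_mul, hure _ hh]; ring
    · simp
  -- The phase over two steps is `conj w ^ 2` or `w ^ 2`, since an apex shared at distance two makes
  -- both edges triangle edges or neither.
  have hv2 : ∀ i, i + 4 ≤ L →
      (inner ℂ (v i) (v (i + 2))).re ≤ (c ^ 2 - 2) / 2 * (t (i + 1) * t (i + 2)) := fun i hi => by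
    rw [hvi i _ (by omega) (by omega)]
    split_ifs with hh
    · rw [hasucc (i + 2), hasucc (i + 1), ← mul_assoc, ← mul_assoc, hau, one_mul]
      by_cases h1 : e (i + 1) = e (i + 2)
      · have h2 : e (i + 2) = e (i + 3) := h1 ▸ hh
        have h3 : (conj w * conj w).re = (c ^ 2 - 2) / 2 := by
          rw [← map_mul, Complex.conj_re, ← sq, re_sq_of_unit hw hc]
        simp only [u, t, h1, h2, if_true, neg_mul_neg, h3]
        simp
      · have h2 : e (i + 2) ≠ e (i + 3) := fun h2 => h1 (hh.trans h2.symm)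
        simp only [u, t, h1, h2, if_false]
        rw [← sq, re_sq_of_unit hw hc]
        linarith
    · have : t (i + 1) * t (i + 2) = 0 := by
        simp only [t]
        split_ifs with h1 h2
        · exact absurd (h1.trans h2) hh
        all_goals simp
      rw [this]; simp
  -- The two `t` terms carry what is already paid for the triangle edge at the end of the sum, whose
  -- compensating cross terms appear only with the next summand. The 8 is slack for the two initial
  -- summands.
  have key : ∀ n, n + 3 ≤ L → ‖∑ i ∈ Finset.range (n + 2), v i‖ ^ 2 ≤
      (n + 2) + 8 + c ^ 2 * t (n + 2) + 2 * c ^ 2 * (t (n + 2) * t (n + 1)) := by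
    intro n
    induction n with
    | zero =>
      intro hL
      have h0 := hvn 0 (by omega)
      have h1 := hvn 1 (by omega)
      have hb : ∀ i, (t i + t (i + 1)) ^ 2 ≤ 4 := fun i => by
        rcases ht i with h | h <;> rcases ht (i + 1) with h' | h' <;> rw [h, h'] <;> norm_num
      have hv0 : ‖v 0‖ ^ 2 ≤ 2 := by nlinarith [hb 0]
      have hv1 : ‖v 1‖ ^ 2 ≤ 2 := by nlinarith [hb 1]
      have hpos : 0 ≤ c ^ 2 * t 2 + 2 * c ^ 2 * (t 2 * t 1) := by
        rcases ht 1 with h | h <;> rcases ht 2 with h' | h' <;> rw [h, h'] <;> positivity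
      simp only [zero_add, Finset.sum_range_succ, Finset.range_zero, Finset.sum_empty,
        CharP.cast_eq_zero]
      have := norm_add_le (v 0) (v 1)
      nlinarith [norm_nonneg (v 0 + v 1), sq_nonneg (‖v 0‖ - ‖v 1‖)]
    | succ n ih =>
      intro hL
      have ih' := ih (by omega)
      have e1 : (inner ℂ (∑ i ∈ Finset.range (n + 2), v i) (v (n + 2))).re =
          (inner ℂ (v n) (v (n + 2))).re + (inner ℂ (v (n + 1)) (v (n + 2))).re := by
        rw [sum_inner, Finset.sum_range_succ, Finset.sum_range_succ, Finset.sum_eq_zero]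
        · simp
        · intro i hi
          exact hvfar _ _ (by have := Finset.mem_range.mp hi; omega) (by omega)
      rw [show n + 1 + 2 = (n + 2) + 1 by ring, Finset.sum_range_succ, @norm_add_sq ℂ]
      simp only [RCLike.re_to_complex]
      rw [e1, hv1 (n + 1) (by omega), hvn (n + 2) (by omega)]
      have e2 := hv2 n (by omega)
      push_cast
      -- Two adjacent triangle edges also produce a defect cross term `2 c ^ 2`; the gain `c ^ 2 -
      -- 2` at distance two outweighs it.
      have hcc : 2 * c ^ 2 - c ≤ 0 := by nlinarith
      rcases ht (n + 1) with h1 | h1 <;> rcases ht (n + 2) with h2 | h2 <;>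
        rcases ht (n + 3) with h3 | h3 <;>
        simp only [show n + 1 + 1 = n + 2 by ring, show n + 2 + 1 = n + 3 by ring, h1, h2, h3]
          at ih' e2 ⊢ <;> nlinarith
  refine gap_le_of_path G hr hgap p e a d (m + 2) 9 (fun i hi => h.adjOp_unitMass_inner (by omega))
    (fun i _ => ?_) ha (fun i j hij hj hh => ?_) ?_
  · have e1 : a i = a (i + 1) * conj (u i) := by
      rw [hasucc, mul_assoc, mul_comm (u i), huu, mul_one]
    rw [hasucc (i + 1), e1]
    simp only [d, Nat.add_sub_cancel]
    rw [← hd1]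
    ring
  · have := h.index_eq (by omega) (by omega) hh
    omega
  · refine (key m hm).trans ?_
    push_cast
    rcases ht (m + 1) with h1 | h1 <;> rcases ht (m + 2) with h2 | h2 <;> rw [h1, h2] <;> nlinarith

end IsCubicGeodesic

end Regimes

/-! ### The detour through the apexes of triangles -/

section Detour

variable {V : Type*}

/-- The edge from `p k` to `p (k + 1)` of a geodesic with third neighbours `e` lies in a triangle,
and the edge before it does not lie in a triangle with the same apex. -/
def IsTriangleStart (e : ℕ → V) (k : ℕ) : Prop := e k = e (k + 1) ∧ e (k - 1) ≠ e k

instance [DecidableEq V] (e : ℕ → V) (k : ℕ) : Decidable (IsTriangleStart e k) :=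
  inferInstanceAs (Decidable (_ ∧ _))

variable [DecidableEq V]

/-- The path that follows the geodesic from its vertex `3` on, but passes through the apex of
every triangle it meets: the state `(k, false)` stands for `p k` and `(k, true)` for `e k`. -/
def detourState (e : ℕ → V) : ℕ → ℕ × Bool
  -- Starting at 3 keeps the indices `k - 1` and `k - 2` used below at least 1, where `e` is
  -- controlled.
  | 0 => (3, false)
  | i + 1 =>
    if (detourState e i).2 = false ∧ IsTriangleStart e (detourState e i).1 then
      ((detourState e i).1, true)
    else ((detourState e i).1 + 1, false)

/-- The vertices of the path described by `detourState`. -/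
def detour (p e : ℕ → V) (i : ℕ) : V :=
  if (detourState e i).2 then e (detourState e i).1 else p (detourState e i).1

/-- The position of `p k` on the detour, up to a constant. -/
def detourIndex (e : ℕ → V) : ℕ → ℕ
  | 0 => 0
  | k + 1 => detourIndex e k + 1 + if IsTriangleStart e k then 1 else 0

lemma detourState_snd {e : ℕ → V} {i : ℕ} (h : (detourState e i).2 = true) :
    IsTriangleStart e (detourState e i).1 := by
  cases i with
  | zero => simp [detourState] at h
  | succ i =>
    rw [detourState] at h ⊢
    split_ifs at h ⊢ with hc
    exact hc.2

lemma three_le_detourState (e : ℕ → V) (i : ℕ) : 3 ≤ (detourState e i).1 := by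
  induction i with
  | zero => simp [detourState]
  | succ i ih => rw [detourState]; split_ifs <;> simp <;> omega

lemma detourState_le (e : ℕ → V) (i : ℕ) : (detourState e i).1 ≤ i + 3 := by
  induction i with
  | zero => simp [detourState]
  | succ i ih => rw [detourState]; split_ifs <;> simp <;> omega

lemma detourIndex_detourState (e : ℕ → V) (i : ℕ) :
    i + detourIndex e 3 =
      detourIndex e (detourState e i).1 + if (detourState e i).2 then 1 else 0 := by
  induction i with
  | zero => simp [detourState]
  | succ i ih =>
    have hs := @detourState_snd _ _ e i
    have hk : detourIndex e ((detourState e i).1 + 1) = detourIndex e (detourState e i).1 + 1 +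
      if IsTriangleStart e (detourState e i).1 then 1 else 0 := rfl
    rw [detourState]
    generalize detourIndex e 3 = n at *
    generalize detourState e i = s at *
    obtain ⟨k, b⟩ := s
    by_cases ht : IsTriangleStart e k <;> cases b <;> simp_all <;> omega

lemma detourState_pred {e : ℕ → V} {i : ℕ} (h : (detourState e (i + 1)).2 = false) :
    (detourState e i).1 + 1 = (detourState e (i + 1)).1 ∧
      ((detourState e i).2 = true ↔ IsTriangleStart e (detourState e i).1) := by
  have hs := @detourState_snd _ _ e i
  rw [detourState] at h ⊢
  split_ifs at h ⊢ with hc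
  refine ⟨rfl, hs, fun ht => ?_⟩
  by_contra hb
  exact hc ⟨by simpa using hb, ht⟩

lemma detourState_pred_true {e : ℕ → V} {i : ℕ} (h : (detourState e (i + 1)).2 = true) :
    (detourState e i).1 = (detourState e (i + 1)).1 ∧ (detourState e i).2 = false := by
  rw [detourState] at h ⊢
  split_ifs at h ⊢ with hc
  exact ⟨rfl, hc.1⟩

/-- The neighbours of `p k` off the detour edges. -/
def IsDetourExtra (p e : ℕ → V) (k : ℕ) (x : V) : Prop :=
  (IsTriangleStart e k ∧ x = p (k + 1)) ∨ (IsTriangleStart e (k - 1) ∧ x = p (k - 1)) ∨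
    (¬ IsTriangleStart e k ∧ ¬ IsTriangleStart e (k - 1) ∧ x = e k)

variable {G : SimpleGraph V}

omit [DecidableEq V] in
lemma IsTriangleStart.not_succ {e : ℕ → V} {k : ℕ} (h : IsTriangleStart e k) :
    ¬ IsTriangleStart e (k + 1) := fun h' => h'.2 h.1

omit [DecidableEq V] in
lemma IsTriangleStart.not_pred {e : ℕ → V} {k : ℕ} (hk : 1 ≤ k) (h : IsTriangleStart e k) :
    ¬ IsTriangleStart e (k - 1) := fun h' => h'.not_succ (by rwa [Nat.sub_add_cancel hk])

namespace IsCubicGeodesic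

variable {p e : ℕ → V} {L : ℕ} (h : IsCubicGeodesic G p e L)
include h

omit [DecidableEq V] in
lemma third_adj_succ {k : ℕ} (h1 : 1 ≤ k) (hk : k + 1 < L) (ht : IsTriangleStart e k) :
    G.Adj (e k) (p (k + 1)) := by
  rw [ht.1]; exact (h.adj_third (by omega) hk).symm

lemma detour_adj {i : ℕ} (hi : i + 5 ≤ L) : G.Adj (detour p e i) (detour p e (i + 1)) := by
  have hk3 := three_le_detourState e i
  have hkL := detourState_le e i
  cases hb : (detourState e (i + 1)).2
  · obtain ⟨h1, h2⟩ := detourState_pred hb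
    simp only [detour, hb, ← h1, Bool.false_eq_true, if_false]
    split_ifs with hc
    · exact h.third_adj_succ (by omega) (by omega) (h2.mp hc)
    · exact h.adj_succ (by omega) (by omega)
  · obtain ⟨h1, h2⟩ := detourState_pred_true hb
    simp only [detour, hb, h2, ← h1, Bool.false_eq_true, if_false, if_true]
    exact h.adj_third (by omega) (by omega)

/-- By `detourIndex_detourState` the state determines the position. Distinct states give distinct
vertices: apexes lie off the geodesic, and two triangle starts with the same apex would be
consecutive. -/
lemma detour_injOn {i j : ℕ} (hi : i + 5 ≤ L) (hj : j + 5 ≤ L)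
    (hij : detour p e i = detour p e j) : i = j := by
  have hi3 := three_le_detourState e i
  have hiL := detourState_le e i
  have hj3 := three_le_detourState e j
  have hjL := detourState_le e j
  have hii := detourIndex_detourState e i
  have hjj := detourIndex_detourState e j
  have his := @detourState_snd _ _ e i
  have hjs := @detourState_snd _ _ e j
  simp only [detour] at hij
  suffices hs : detourState e i = detourState e j by
    rw [hs] at hii; omega
  generalize detourState e i = s at *
  generalize detourState e j = t at *
  obtain ⟨k, b⟩ := s
  obtain ⟨k', b'⟩ := t
  simp only at *
  cases b <;> cases b' <;> simp only [Bool.false_eq_true, if_false, if_true] at hij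
  · rw [h.index_eq (by omega) (by omega) hij]
  · exact absurd hij.symm (h.third_ne (by omega) (by omega) (by omega))
  · exact absurd hij (h.third_ne (by omega) (by omega) (by omega))
  · have aux : ∀ k k', 3 ≤ k → k + 1 < L → k' + 1 < L → IsTriangleStart e k →
        IsTriangleStart e k' → e k = e k' → ¬ k < k' := by
      intro k k' hk hkL hkL' ht ht' hee hlt
      have := h.index_le_of_third_eq (i := k) (j := k' + 1) (by omega) (by omega) (by omega)
        (by omega) (hee.trans ht'.1)
      obtain rfl : k' = k + 1 := by omega
      exact ht'.2 hee
    have h1 := aux k k' hi3 (by omega) (by omega) (his rfl) (hjs rfl) hij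
    have h2 := aux k' k hj3 (by omega) (by omega) (hjs rfl) (his rfl) hij.symm
    rw [show k = k' by omega]

lemma isDetourExtra {i : ℕ} (hi : i + 7 ≤ L) (hb : (detourState e (i + 1)).2 = false) {x : V}
    (hx : G.Adj (detour p e (i + 1)) x) (hl : x ≠ detour p e i) (hr : x ≠ detour p e (i + 2)) :
    IsDetourExtra p e (detourState e (i + 1)).1 x := by
  have hi3 := three_le_detourState e i
  have hiL := detourState_le e i
  obtain ⟨h1, h2⟩ := detourState_pred hb
  have hd : detourState e (i + 2) = if (detourState e (i + 1)).2 = false ∧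
      IsTriangleStart e (detourState e (i + 1)).1 then ((detourState e (i + 1)).1, true)
    else ((detourState e (i + 1)).1 + 1, false) := by rw [detourState]
  simp only [detour, hd, hb, ← h1, true_and, Bool.false_eq_true, if_false] at hx hl hr
  rw [← h1]
  generalize (detourState e i).1 = k at *
  by_cases ht : IsTriangleStart e (k + 1)
  · have ht' := ht.not_pred (by omega)
    simp only [Nat.add_sub_cancel] at ht'
    rw [if_neg (fun hc => ht' (h2.mp hc))] at hl
    simp only [ht, if_true] at hr
    refine Or.inl ⟨ht, ?_⟩
    by_contra hne
    exact hr (h.eq_third (by omega) (by omega) hx hl hne)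
  · simp only [ht, if_false, Bool.false_eq_true] at hr
    refine Or.inr ?_
    simp only [Nat.add_sub_cancel]
    by_cases ht' : IsTriangleStart e k
    · rw [if_pos (h2.mpr ht'), ht'.1] at hl
      refine Or.inl ⟨ht', ?_⟩
      by_contra hne
      exact hl (h.eq_third (by omega) (by omega) hx hne hr)
    · rw [if_neg (fun hc => ht' (h2.mp hc))] at hl
      exact Or.inr ⟨ht, ht', h.eq_third (by omega) (by omega) hx hl hr⟩

/-- Only `x = e k = e k'` survives. If `k' = k + 1`, then neither `k` nor `k - 1` being a triangle
start forces four consecutive vertices to share a third neighbour, against the geodesic. So `k' = k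
+ 2`, with at most one apex inserted between. -/
lemma extra_false_false {k k' : ℕ} (hk : 3 ≤ k) (hkk : k < k') (hL : k' + 1 < L) {x : V}
    (hx : IsDetourExtra p e k x) (hx' : IsDetourExtra p e k' x) :
    detourIndex e k' = detourIndex e k + 2 ∨ detourIndex e k' = detourIndex e k + 3 := by
  rcases hx with ⟨ht, rfl⟩ | ⟨ht, rfl⟩ | ⟨ht, ht1, rfl⟩
  · rcases hx' with ⟨ht', hx'⟩ | ⟨ht', hx'⟩ | ⟨ht', _, hx'⟩
    · have := h.index_eq (by omega) (by omega) hx'; omega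
    · have := h.index_eq (by omega) (by omega) hx'
      rw [← this] at ht'
      exact absurd ht' ht.not_succ
    · exact absurd hx'.symm (h.third_ne (by omega) (by omega) (by omega))
  · rcases hx' with ⟨ht', hx'⟩ | ⟨ht', hx'⟩ | ⟨ht', _, hx'⟩
    · have := h.index_eq (by omega) (by omega) hx'; omega
    · have := h.index_eq (by omega) (by omega) hx'; omega
    · exact absurd hx'.symm (h.third_ne (by omega) (by omega) (by omega))
  · rcases hx' with ⟨ht', hx'⟩ | ⟨ht', hx'⟩ | ⟨ht', _, hx'⟩
    · exact absurd hx' (h.third_ne (by omega) (by omega) (by omega))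
    · exact absurd hx' (h.third_ne (by omega) (by omega) (by omega))
    · have := h.index_le_of_third_eq (by omega) (by omega) (by omega) (by omega) hx'
      rcases (by omega : k' = k + 1 ∨ k' = k + 2) with rfl | rfl
      · exfalso
        have h1 : e (k - 1) = e k := by
          by_contra hne; exact ht ⟨hx', hne⟩
        have h2 : e (k - 1 - 1) = e (k - 1) := by
          by_contra hne
          exact ht1 ⟨by rwa [Nat.sub_add_cancel (by omega)], hne⟩
        have := h.index_le_of_third_eq (i := k - 1 - 1) (j := k + 1) (by omega) (by omega) (by omega)
          (by omega) (h2.trans (h1.trans hx'))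
        omega
      · simp only [detourIndex, ht, if_false]
        split_ifs <;> omega

/-- If `x` were on the geodesic, the apex `e k'` would be its third neighbour as well, which is too
far or makes consecutive triangle starts. Hence `x = e k`, and the walk `p k, x, e k', p (k' + 1)`
gives `k' ≤ k + 2`. -/
lemma extra_false_true {k k' : ℕ} (hk : 3 ≤ k) (hkk : k ≤ k') (hL : k' + 2 < L) {x : V}
    (hx : IsDetourExtra p e k x) (ht' : IsTriangleStart e k') (hx' : G.Adj (e k') x)
    (h1 : x ≠ p k') (h2 : x ≠ p (k' + 1)) :
    detourIndex e k' + 1 = detourIndex e k + 2 ∨ detourIndex e k' + 1 = detourIndex e k + 3 := by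
  rcases hx with ⟨ht, rfl⟩ | ⟨ht, rfl⟩ | ⟨ht, ht1, rfl⟩
  · exfalso
    have h3 : k ≠ k' := fun hh => h2 (by rw [hh])
    have h4 : k + 1 ≠ k' := fun hh => h1 (by rw [hh])
    have h5 : e k' = e (k + 1) := h.eq_third (by omega) (by omega) hx'.symm
      (h.third_ne (by omega) (by omega) (by omega)) (h.third_ne (by omega) (by omega) (by omega))
    have := h.index_le_of_third_eq (i := k) (j := k' + 1) (by omega) (by omega) (by omega)
      (by omega) (ht.1.trans (h5.symm.trans ht'.1))
    omega
  · exfalso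
    have h5 : e k' = e (k - 1) := h.eq_third (by omega) (by omega) hx'.symm
      (h.third_ne (by omega) (by omega) (by omega)) (h.third_ne (by omega) (by omega) (by omega))
    have := h.index_le_of_third_eq (i := k - 1) (j := k' + 1) (by omega) (by omega) (by omega)
      (by omega) (h5.symm.trans ht'.1)
    obtain rfl : k = k' := by omega
    exact ht'.not_pred (by omega) ht
  · have h3 : k ≠ k' := fun hh => ht (hh ▸ ht')
    have := h.index_le_add_three (i := k) (j := k' + 1) (by omega) (by omega)
      (h.adj_third (by omega) (by omega)) hx'.symm (h.third_adj_succ (by omega) (by omega) ht')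
    rcases (by omega : k' = k + 1 ∨ k' = k + 2) with rfl | rfl
    · simp [detourIndex, ht]
    · have := ht'.not_pred (by omega)
      simp only [show k + 2 - 1 = k + 1 by omega] at this
      simp [detourIndex, ht, this]

/-- As in `extra_false_true`, `x = e k'`, and the walk `p k, e k, x, p k'` gives `k' ≤ k + 3`; `k' =
k + 1` would make `x` the apex itself. -/
lemma extra_true_false {k k' : ℕ} (hk : 3 ≤ k) (hkk : k < k') (hL : k' + 2 < L) {x : V}
    (ht : IsTriangleStart e k) (hx : G.Adj (e k) x) (h1 : x ≠ p k) (h2 : x ≠ p (k + 1))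
    (hx' : IsDetourExtra p e k' x) :
    detourIndex e k' = detourIndex e k + 1 + 2 ∨ detourIndex e k' = detourIndex e k + 1 + 3 := by
  rcases hx' with ⟨ht', rfl⟩ | ⟨ht', rfl⟩ | ⟨ht', ht1, rfl⟩
  · exfalso
    have h5 : e k = e (k' + 1) := h.eq_third (by omega) (by omega) hx.symm
      (h.third_ne (by omega) (by omega) (by omega)) (h.third_ne (by omega) (by omega) (by omega))
    have := h.index_le_of_third_eq (i := k) (j := k' + 1) (by omega) (by omega) (by omega)
      (by omega) h5
    obtain rfl : k' = k + 1 := by omega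
    exact ht.not_succ ht'
  · exfalso
    have h3 : k' - 1 ≠ k := fun hh => h1 (by rw [hh])
    have h4 : k' - 1 ≠ k + 1 := fun hh => h2 (by rw [hh])
    have h5 : e k = e (k' - 1) := h.eq_third (by omega) (by omega) hx.symm
      (h.third_ne (by omega) (by omega) (by omega)) (h.third_ne (by omega) (by omega) (by omega))
    have h6 := ht'.1
    rw [Nat.sub_add_cancel (by omega)] at h6
    have := h.index_le_of_third_eq (i := k) (j := k') (by omega) (by omega) (by omega)
      (by omega) (h5.trans h6)
    omega
  · have := h.index_le_add_three (i := k) (j := k') (by omega) (by omega)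
      (h.adj_third (by omega) (by omega)) hx (h.adj_third (by omega) (by omega)).symm
    rcases (by omega : k' = k + 1 ∨ k' = k + 2 ∨ k' = k + 3) with rfl | rfl | rfl
    · exfalso
      rw [← ht.1] at hx
      exact G.irrefl hx
    · simp [detourIndex, ht, ht.not_succ]
    · simp only [show k + 3 - 1 = k + 2 by omega] at ht1
      simp [detourIndex, ht, ht.not_succ, ht1]

/-- The walk `p k, e k, x, e k', p (k' + 1)` gives `k' ≤ k + 3`, and triangle starts are never
consecutive. -/
lemma extra_true_true {k k' : ℕ} (hk : 3 ≤ k) (hkk : k < k') (hL : k' + 2 < L) {x : V}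
    (ht : IsTriangleStart e k) (hx : G.Adj (e k) x)
    (ht' : IsTriangleStart e k') (hx' : G.Adj (e k') x) :
    detourIndex e k' = detourIndex e k + 3 ∨
      (k' = k + 3 ∧ detourIndex e k' = detourIndex e k + 4) := by
  have := h.index_le_add_four (i := k) (j := k' + 1) (by omega) (by omega)
      (h.adj_third (by omega) (by omega)) hx hx'.symm (h.third_adj_succ (by omega) (by omega) ht')
  rcases (by omega : k' = k + 1 ∨ k' = k + 2 ∨ k' = k + 3) with rfl | rfl | rfl
  · exact absurd ht' ht.not_succ
  · simp [detourIndex, ht, ht.not_succ]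
  · have := ht'.not_pred (by omega)
    simp only [show k + 3 - 1 = k + 2 by omega] at this
    simp [detourIndex, ht, ht.not_succ, this]

/-- Two vertices of the detour with a common neighbour off the detour edges are two or three steps
apart, or four steps in the case of two triangles whose apexes have a common neighbour. -/
lemma detour_sub {i j : ℕ} (hij : i < j) (hj : j + 7 ≤ L) {x : V}
    (hi : G.Adj (detour p e (i + 1)) x) (hil : x ≠ detour p e i) (hir : x ≠ detour p e (i + 2))
    (hjx : G.Adj (detour p e (j + 1)) x) (hjl : x ≠ detour p e j) (hjr : x ≠ detour p e (j + 2)) :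
    j - i = 2 ∨ j - i = 3 ∨ (j - i = 4 ∧ ∃ k, 3 ≤ k ∧ k + 5 < L ∧ IsTriangleStart e k ∧
      IsTriangleStart e (k + 3) ∧ G.Adj (e k) x ∧ G.Adj (e (k + 3)) x) := by
  have hi3 := three_le_detourState e (i + 1)
  have hiL := detourState_le e (i + 1)
  have hj3 := three_le_detourState e (j + 1)
  have hjL := detourState_le e (j + 1)
  have hii := detourIndex_detourState e (i + 1)
  have hjj := detourIndex_detourState e (j + 1)
  have hmono : Monotone (detourIndex e) := monotone_nat_of_le_succ fun k => by
    rw [detourIndex]; omega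
  have htrue : ∀ i, (detourState e (i + 1)).2 = true → G.Adj (detour p e (i + 1)) x →
      x ≠ detour p e i → x ≠ detour p e (i + 2) → G.Adj (e (detourState e (i + 1)).1) x ∧
      x ≠ p (detourState e (i + 1)).1 ∧ x ≠ p ((detourState e (i + 1)).1 + 1) := by
    intro i hb hx hl hr
    obtain ⟨h1, h2⟩ := detourState_pred_true hb
    have hd : detourState e (i + 2) = if (detourState e (i + 1)).2 = false ∧
        IsTriangleStart e (detourState e (i + 1)).1 then ((detourState e (i + 1)).1, true)
      else ((detourState e (i + 1)).1 + 1, false) := by rw [detourState]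
    simp only [detour, hd, hb, h1, h2, if_true, Bool.false_eq_true, if_false, false_and,
      reduceCtorEq] at hx hl hr
    exact ⟨hx, hl, hr⟩
  have hTi := @detourState_snd _ _ e (i + 1)
  have hTj := @detourState_snd _ _ e (j + 1)
  have hFi := fun hb => h.isDetourExtra (i := i) (by omega) hb hi hil hir
  have hFj := fun hb => h.isDetourExtra (i := j) (by omega) hb hjx hjl hjr
  have hAi := fun hb => htrue i hb hi hil hir
  have hAj := fun hb => htrue j hb hjx hjl hjr
  clear htrue hi hil hir hjx hjl hjr
  generalize detourState e (i + 1) = s at *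
  generalize detourState e (j + 1) = t at *
  obtain ⟨k, b⟩ := s
  obtain ⟨k', b'⟩ := t
  have hlt : k' < k → detourIndex e k' < detourIndex e k := fun hkk =>
    lt_of_lt_of_le (by rw [detourIndex]; omega) (hmono (Nat.succ_le_of_lt hkk))
  cases b <;> cases b' <;>
    simp only [Bool.false_eq_true, if_false, if_true, forall_const, false_imp_iff,
      reduceCtorEq] at *
  · have hkk : k < k' := by
      by_contra! hle
      rcases hle.lt_or_eq with h1 | rfl
      · have := hlt h1; omega
      · omega
    have := h.extra_false_false hi3 hkk (by omega) hFi hFj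
    omega
  · have hkk : k ≤ k' := by
      by_contra! hle
      have := hlt hle; omega
    have := h.extra_false_true hi3 hkk (by omega) hFi hTj hAj.1 hAj.2.1 hAj.2.2
    omega
  · have hkk : k < k' := by
      by_contra! hle
      rcases hle.lt_or_eq with h1 | rfl
      · have := hlt h1; omega
      · omega
    have := h.extra_true_false hi3 hkk (by omega) hTi hAi.1 hAi.2.1 hAi.2.2 hFj
    omega
  · have hkk : k < k' := by
      by_contra! hle
      rcases hle.lt_or_eq with h1 | rfl
      · have := hlt h1; omega
      · omega
    rcases h.extra_true_true hi3 hkk (by omega) hTi hAi.1 hTj hAj.1 with h1 | ⟨rfl, h1⟩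
    · omega
    · exact Or.inr (Or.inr ⟨by omega, k, hi3, by omega, hTi, hTj, hAi.1, hAj.1⟩)

end IsCubicGeodesic

end Detour

/-! ### The case `1/2 ≤ c`: the detour and the hexagon -/

section Detour

open ComplexConjugate

variable {V : Type*} [Fintype V] [DecidableEq V] {G : SimpleGraph V} [DecidableRel G.Adj]

lemma norm_sq_add_smul_unitMass {f : EuclideanSpace ℂ V} {v : V} (s : ℂ) (hf : f v = 0) :
    ‖f + s • unitMass v‖ ^ 2 = ‖f‖ ^ 2 + ‖s‖ ^ 2 := by
  have : inner ℂ f (s • unitMass v) = 0 := by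
    rw [inner_smul_right, unitMass, EuclideanSpace.inner_single_right]; simp [hf]
  rw [@norm_add_sq ℂ, this, norm_smul, norm_unitMass]
  simp

/-- A test function on a hexagon `v, m, u, w', x, w` with two chords `v w` and `u w'`. -/
lemma not_gap_of_hexagon_adjOp {c r : ℝ} (hr : 1 < r)
    (hgap : ∀ l ∈ spectrum ℝ (G.adjMatrix ℝ), r ≤ |l - c|) (hc1 : 1 / 2 ≤ c) (hc2 : c ≤ 4 / 5)
    {v m u w w' x a b m' y : V}
    (hTv : adjOp G (unitMass v) = unitMass a + (unitMass m + unitMass w))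
    (hTm : adjOp G (unitMass m) = unitMass v + (unitMass u + unitMass m'))
    (hTu : adjOp G (unitMass u) = unitMass m + (unitMass b + unitMass w'))
    (hTw : adjOp G (unitMass w) = unitMass a + unitMass v + unitMass x)
    (hTw' : adjOp G (unitMass w') = unitMass u + unitMass b + unitMass x)
    (hTx : adjOp G (unitMass x) = unitMass w + unitMass w' + unitMass y)
    (hvw : v ≠ w) (hvu : v ≠ u) (hvw' : v ≠ w') (hvm : v ≠ m) (hvx : v ≠ x) (hwu : w ≠ u)
    (hww' : w ≠ w') (hwm : w ≠ m) (hwx : w ≠ x) (huw' : u ≠ w') (hum : u ≠ m) (hux : u ≠ x)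
    (hwm' : w' ≠ m) (hwx' : w' ≠ x) (hmx : m ≠ x)
    (h1 : m' ≠ v) (h2 : m' ≠ w) (h3 : m' ≠ u) (h4 : m' ≠ w') (h5 : m' ≠ m)
    (h6 : y ≠ v) (h7 : y ≠ w) (h8 : y ≠ u) (h9 : y ≠ w') (hyx : y ≠ x) : False := by
  let F : ℝ → ℝ → EuclideanSpace ℂ V := fun s t =>
    (0 : EuclideanSpace ℂ V) + (s : ℂ) • unitMass v + (-s : ℂ) • unitMass w + (s : ℂ) • unitMass u +
      (-s : ℂ) • unitMass w' + (t : ℂ) • unitMass m + (-t : ℂ) • unitMass x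
  have hF : ∀ s t, ‖F s t‖ ^ 2 = 4 * s ^ 2 + 2 * t ^ 2 := fun s t => by
    simp only [F]
    rw [norm_sq_add_smul_unitMass, norm_sq_add_smul_unitMass, norm_sq_add_smul_unitMass,
      norm_sq_add_smul_unitMass, norm_sq_add_smul_unitMass, norm_sq_add_smul_unitMass]
    · simp only [norm_zero, norm_neg, Complex.norm_real, Real.norm_eq_abs, sq_abs]; ring
    · simp
    · simp [unitMass_apply, hvw.symm]
    · simp [unitMass_apply, hvu.symm, hwu.symm]
    · simp [unitMass_apply, hvw'.symm, hww'.symm, huw'.symm]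
    · simp [unitMass_apply, hvm.symm, hwm.symm, hum.symm, hwm'.symm]
    · simp [unitMass_apply, hvx.symm, hwx.symm, hux.symm, hwx'.symm, hmx.symm]
  -- The opposite signs on `v, w` and on `u, w'` cancel at `a` and `b`, so mass leaves the hexagon
  -- only towards `m'` and `y`. The values 2 and 3 give squared norm 34 against at most `34 c ^ 2 -
  -- 64 c + 54`, which is less than 34 for `1/2 ≤ c ≤ 4/5`.
  have hT : adjOp G (F 2 3) - (c : ℂ) • F 2 3 =
      F (1 - 2 * c) (4 - 3 * c) + (3 : ℂ) • (unitMass m' - unitMass y) := by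
    simp only [F, map_add, map_zero, map_smul, hTv, hTw, hTm, hTu, hTw', hTx]
    push_cast
    module
  -- The only possible coincidences are `m' = x` and `y = m`, and both contribute with negative
  -- sign.
  have hi : (inner ℂ (F (1 - 2 * c) (4 - 3 * c)) ((3 : ℂ) • (unitMass m' - unitMass y))).re ≤ 0 := by
    rw [inner_smul_right, inner_sub_right, unitMass, unitMass, EuclideanSpace.inner_single_right,
      EuclideanSpace.inner_single_right]
    simp only [F, PiLp.add_apply, PiLp.smul_apply, PiLp.zero_apply, unitMass_apply, h1, h2, h3, h4,
      h5, h6, h7, h8, h9, hyx, if_false]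
    split_ifs <;> simp <;> linarith
  have hd : ‖(3 : ℂ) • (unitMass m' - unitMass y)‖ ^ 2 ≤ 18 := by
    rw [norm_smul, mul_pow, @norm_sub_sq ℂ, norm_unitMass, norm_unitMass, inner_unitMass]
    split_ifs <;> norm_num
  have hle := le_norm_adjOp_sub G (by linarith) hgap (F 2 3)
  have hle2 : ‖adjOp G (F 2 3) - (c : ℂ) • F 2 3‖ ^ 2 ≤
      4 * (1 - 2 * c) ^ 2 + 2 * (4 - 3 * c) ^ 2 + 18 := by
    rw [hT, @norm_add_sq ℂ, hF]
    simp only [RCLike.re_to_complex]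
    linarith
  have hle3 : ‖F 2 3‖ ≤ ‖adjOp G (F 2 3) - (c : ℂ) • F 2 3‖ := by
    nlinarith [norm_nonneg (F 2 3)]
  have hle4 := pow_le_pow_left₀ (norm_nonneg _) hle3 2
  rw [hF] at hle4
  nlinarith

namespace IsCubicGeodesic

variable {p e : ℕ → V} {L : ℕ} (h : IsCubicGeodesic G p e L)
include h

/-- Two triangles on a geodesic at distance two whose apexes have a common neighbour carry a test
function supported on a hexagon. -/
lemma not_gap_of_hexagon (hG : G.IsRegularOfDegree 3) {c r : ℝ} (hr : 1 < r)
    (hgap : ∀ l ∈ spectrum ℝ (G.adjMatrix ℝ), r ≤ |l - c|) (hc1 : 1 / 2 ≤ c) (hc2 : c ≤ 4 / 5)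
    {k : ℕ} (hk : 3 ≤ k) (hL : k + 5 < L) (ht : IsTriangleStart e k)
    (ht' : IsTriangleStart e (k + 3)) {x : V} (hx : G.Adj (e k) x) (hx' : G.Adj (e (k + 3)) x) :
    False := by
  have hww : e k ≠ e (k + 3) := fun hh => by
    have := h.index_le_of_third_eq (i := k) (j := k + 3) (by omega) (by omega) (by omega)
      (by omega) hh
    omega
  have hpp : ∀ i j, i < j → j ≤ L → p i ≠ p j := fun i j hij hj hh => by
    have := h.index_eq (by omega) hj hh; omega
  have hep : ∀ i j, 1 ≤ i → i < L → j ≤ L → e i ≠ p j := fun i j hi hi' hj =>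
    h.third_ne hi hi' hj
  have hthird : ∀ i j, 3 ≤ i → i + 2 < L → 1 ≤ j → j < L → G.Adj (e j) (p i) → e j = e i :=
    fun i j hi hi' hj hj' ha => h.eq_third (by omega) (by omega) ha.symm
      (hep _ _ hj hj' (by omega)) (hep _ _ hj hj' (by omega))
  have hxp : ∀ i, 3 ≤ i → i + 2 < L → x ≠ p i := by
    rintro i hi hi' rfl
    exact hww ((hthird i k hi hi' (by omega) (by omega) hx).trans
      (hthird i (k + 3) hi hi' (by omega) (by omega) hx').symm)
  have hxk := hxp k hk (by omega)
  have hxv := hxp (k + 1) (by omega) (by omega)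
  have hxm := hxp (k + 2) (by omega) (by omega)
  have hxu2 := hxp (k + 3) (by omega) (by omega)
  have hxv2 : x ≠ p (k + 4) := by
    rintro rfl
    have : e k = e (k + 4) := h.eq_third (by omega) (by omega) hx.symm
      (hep _ _ (by omega) (by omega) (by omega)) (hep _ _ (by omega) (by omega) (by omega))
    exact hww (this.trans ht'.1.symm)
  have hwk : G.Adj (e k) (p k) := (h.adj_third (by omega) (by omega)).symm
  have hwk1 := h.third_adj_succ (k := k) (by omega) (by omega) ht
  have hw2k : G.Adj (e (k + 3)) (p (k + 3)) := (h.adj_third (by omega) (by omega)).symm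
  have hw2k1 := h.third_adj_succ (k := k + 3) (by omega) (by omega) ht'
  have hTw : adjOp G (unitMass (e k)) = unitMass (p k) + unitMass (p (k + 1)) + unitMass x := by
    obtain ⟨z, hz, -⟩ := exists_third_neighbor hG hwk hwk1 (hpp _ _ (by omega) (by omega))
    obtain rfl : x = z := by
      rcases (hz x).mp hx with h1 | h1 | h1
      exacts [absurd h1 hxk, absurd h1 hxv, h1]
    exact adjOp_unitMass G hz (hpp _ _ (by omega) (by omega)) hxk.symm hxv.symm
  have hTw2 : adjOp G (unitMass (e (k + 3))) =
      unitMass (p (k + 3)) + unitMass (p (k + 4)) + unitMass x := by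
    obtain ⟨z, hz, -⟩ := exists_third_neighbor hG hw2k hw2k1 (hpp _ _ (by omega) (by omega))
    obtain rfl : x = z := by
      rcases (hz x).mp hx' with h1 | h1 | h1
      exacts [absurd h1 hxu2, absurd h1 hxv2, h1]
    exact adjOp_unitMass G hz (hpp _ _ (by omega) (by omega)) hxu2.symm hxv2.symm
  obtain ⟨y, hy, hwy, hw2y⟩ := exists_third_neighbor hG hx.symm hx'.symm hww
  have hTx := adjOp_unitMass G hy hww hwy hw2y
  have hTv := h.adjOp_unitMass_inner (k := k) (by omega)
  have hTm := h.adjOp_unitMass_inner (k := k + 1) (by omega)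
  have hTu2 := h.adjOp_unitMass_inner (k := k + 2) (by omega)
  rw [← ht.1] at hTv
  simp only [add_assoc, Nat.reduceAdd] at hTv hTm hTu2
  have hyx : G.Adj x y := (hy y).mpr (by simp)
  have hyv : y ≠ p (k + 1) := by
    rintro rfl
    have := h.eq_third (by omega) (by omega) hyx.symm hxk hxm
    rw [← ht.1] at this
    exact hx.ne this.symm
  have hyu2 : y ≠ p (k + 3) := by
    rintro rfl
    exact hx'.ne (h.eq_third (by omega) (by omega) hyx.symm hxm hxv2).symm
  have hmw : e (k + 2) ≠ e k := by
    intro hh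
    have ha := h.adj_third (k := k + 2) (by omega) (by omega)
    rw [hh] at ha
    -- Evaluating `hTw` at `p (k + 2)` shows that this vertex is not a neighbour of `e k`.
    have h1 := congrArg (fun f : EuclideanSpace ℂ V => f (p (k + 2))) hTw
    rw [adjOp_apply] at h1
    simp [unitMass_apply, (hpp k (k + 2) (by omega) (by omega)).symm,
      (hpp (k + 1) (k + 2) (by omega) (by omega)).symm, hxm.symm] at h1
    exact h1 ha
  have hmw2 : e (k + 2) ≠ e (k + 3) := ht'.2
  have e1 := hep k (k + 1) (by omega) (by omega) (by omega)
  have e2 := hep k (k + 2) (by omega) (by omega) (by omega)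
  have e3 := hep k (k + 3) (by omega) (by omega) (by omega)
  have e4 := hep (k + 3) (k + 1) (by omega) (by omega) (by omega)
  have e5 := hep (k + 3) (k + 2) (by omega) (by omega) (by omega)
  have e6 := hep (k + 3) (k + 3) (by omega) (by omega) (by omega)
  have e7 := hep (k + 2) (k + 1) (by omega) (by omega) (by omega)
  have e8 := hep (k + 2) (k + 2) (by omega) (by omega) (by omega)
  have e9 := hep (k + 2) (k + 3) (by omega) (by omega) (by omega)
  have p1 := hpp (k + 1) (k + 2) (by omega) (by omega)
  have p2 := hpp (k + 1) (k + 3) (by omega) (by omega)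
  have p3 := hpp (k + 2) (k + 3) (by omega) (by omega)
  have hwx := hx.ne
  have hw2x := hx'.ne
  exact not_gap_of_hexagon_adjOp hr hgap hc1 hc2 hTv hTm hTu2 hTw hTw2 hTx e1.symm
    p2 e4.symm p1 hxv.symm e3 hww e2 hwx e6.symm p3.symm hxu2.symm e5 hw2x hxm.symm
    e7 hmw e9 hmw2 e8 hyv hwy.symm hyu2 hw2y.symm hyx.ne.symm

lemma gap_le_of_half_le (hG : G.IsRegularOfDegree 3) {c r : ℝ} (hr : 1 < r)
    (hgap : ∀ l ∈ spectrum ℝ (G.adjMatrix ℝ), r ≤ |l - c|) (hc1 : 1 / 2 ≤ c) (hc2 : c ^ 2 ≤ 2)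
    {m : ℕ} (hm : m + 7 ≤ L) : r * √m ≤ √(m + 0) + 4 := by
  obtain ⟨w, hw, hc⟩ := exists_unit_add_conj_eq (c := c) (abs_le_of_sq_le_sq (by linarith) two_pos.le)
  have hex : ∀ i, ∃ s, i + 7 ≤ L → (∀ x, G.Adj (detour p e (i + 1)) x ↔
      x = detour p e i ∨ x = detour p e (i + 2) ∨ x = s) ∧
      detour p e i ≠ s ∧ detour p e (i + 2) ≠ s := by
    intro i
    by_cases hi : i + 7 ≤ L
    · obtain ⟨s, hs⟩ := exists_third_neighbor hG (h.detour_adj (i := i) (by omega)).symm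
        (h.detour_adj (i := i + 1) (by omega)) fun hh => by
          have := h.detour_injOn (by omega) (by omega) hh; omega
      exact ⟨s, fun _ => hs⟩
    · exact ⟨p 0, fun hh => by omega⟩
  choose s hs using hex
  refine gap_le_of_path_pow (by linarith) hgap hw hc (detour p e) (fun i => s (i - 1)) m
    (fun i hi => ?_) (fun i j hij hj hh => ?_) (fun i j hij hj hh => ?_)
  · obtain ⟨h1, h2, h3⟩ := hs i (by omega)
    refine adjOp_unitMass G h1 (fun hh => ?_) h2 h3
    have := h.detour_injOn (by omega) (by omega) hh; omega
  · have := h.detour_injOn (by omega) (by omega) hh; omega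
  · simp only [Nat.add_sub_cancel] at hh
    obtain ⟨h1, h2, h3⟩ := hs i (by omega)
    obtain ⟨h4, h5, h6⟩ := hs j (by omega)
    rw [← hh] at h4 h5 h6
    rcases h.detour_sub hij (by omega) ((h1 (s i)).mpr (by simp)) h2.symm h3.symm
      ((h4 (s i)).mpr (by simp)) h5.symm h6.symm with h7 | h7 | ⟨h7, k, hk3, hkL, ht, ht', hx, hx'⟩
    · rw [h7, re_sq_of_unit hw hc]; linarith
    · rw [h7, re_pow_three_of_unit hw hc]; nlinarith
    -- `Re (w ^ 4) ≤ 0` needs `c ^ 2 ≥ 2 - √2`, that is `c` above about 0.766; for smaller `c` the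
    -- hexagon gives the contradiction.
    · by_cases hc4 : c ≤ 4 / 5
      · exact (h.not_gap_of_hexagon hG hr hgap hc1 hc4 hk3 hkL ht ht' hx hx').elim
      · push Not at hc4
        rw [h7, re_pow_four_of_unit hw hc]
        nlinarith [mul_nonneg (sub_nonneg.mpr hc2) (show 0 ≤ c ^ 2 - 16 / 25 by nlinarith)]

end IsCubicGeodesic

/-- The spectrum of a large cubic graph meets every interval of radius greater than `1` with centre
in `[-√2, √2]`. -/
theorem exists_card_bound_of_gap {c r : ℝ} (hc : c ^ 2 ≤ 2) (hr : 1 < r) :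
    ∃ N : ℕ, ∀ {V : Type} [Fintype V] [DecidableEq V] (G : SimpleGraph V) [DecidableRel G.Adj],
      G.Connected → G.IsRegularOfDegree 3 → N ≤ Fintype.card V →
      ∃ l ∈ spectrum ℝ (G.adjMatrix ℝ), |l - c| < r := by
  obtain ⟨m, -, hm⟩ := exists_sqrt_add_lt hr 0
  obtain ⟨m', h2, hm'⟩ := exists_sqrt_add_lt hr 9
  refine ⟨(∑ j ∈ Finset.range (m + m' + 7), 3 ^ j) + 1, fun {V} _ _ G _ hconn hG hN => ?_⟩
  by_contra! hgap
  obtain ⟨p, e, h⟩ := exists_isCubicGeodesic hG hconn (m + m' + 7) (by omega)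
  rcases le_total c 0 with h0 | h0
  · exact absurd (h.gap_le_of_nonpos (by linarith) hgap h0 hc (m := m) (by omega)) (not_le.mpr hm)
  rcases le_total c (1 / 2) with h1 | h1
  · obtain ⟨n, rfl⟩ := Nat.exists_eq_add_of_le' h2
    exact absurd (h.gap_le_of_le_half (by linarith) hgap h0 h1 (m := n) (by omega))
      (not_le.mpr hm')
  · exact absurd (h.gap_le_of_half_le hG hr hgap h1 hc (m := m) (by omega)) (not_le.mpr hm)

end Detour

lemma IsSpectralSet.inter_nonempty {K : Set ℝ} (hK : IsSpectralSet K) {I : Set ℝ}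
    (hI : I.OrdConnected) (hsub : I ⊆ Set.Ioo (-1 - √2) (1 + √2)) (hd : 2 < Metric.diam I) :
    (I ∩ K).Nonempty := by
  obtain ⟨a, ha, b, hb, hab⟩ : ∃ a ∈ I, ∃ b ∈ I, 2 < b - a := by
    by_contra! hcon
    refine hd.not_ge (Metric.diam_le_of_forall_dist_le zero_le_two fun x hx y hy => ?_)
    rw [Real.dist_eq, abs_le]
    constructor <;> linarith [hcon x hx y hy, hcon y hy x hx]
  have ha' := hsub ha
  have hb' := hsub hb
  -- The ends lie within `1 + √2` of 0 and are more than 2 apart, so the midpoint lies within `√2`.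
  have hc : ((a + b) / 2) ^ 2 ≤ 2 :=
    (sq_le_sq' (by linarith [ha'.1]) (by linarith [hb'.2])).trans_eq (Real.sq_sqrt zero_le_two)
  obtain ⟨N, hN⟩ := exists_card_bound_of_gap hc (r := (b - a) / 2) (by linarith)
  obtain ⟨n, hn, G, ⟨hconn, hreg⟩, hG⟩ := hK.2.2 N
  classical
  obtain ⟨l, hl, hlc⟩ := hN G hconn (by convert hreg) (by simpa using hn)
  rw [abs_lt] at hlc
  refine ⟨l, hI.out ha hb ⟨by linarith, by linarith⟩, hG ?_⟩
  rw [adjSpectrum]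
  convert hl

/-! ### Integrality of the discriminant -/

section Discriminant

open Polynomial

/-- The discriminant of a squarefree monic integral polynomial with real roots is at least `1` in
absolute value. -/
lemma one_le_prod_abs_sub_roots {p : ℤ[X]} (hp : p.Monic)
    (hsq : Squarefree (p.map (Int.castRingHom ℚ))) (hs : (p.map (Int.castRingHom ℝ)).Splits) :
    1 ≤ ∏ x ∈ (p.map (Int.castRingHom ℝ)).roots.toFinset,
      ∏ y ∈ (p.map (Int.castRingHom ℝ)).roots.toFinset.erase x, |x - y| := by
  have hsep : (p.map (Int.castRingHom ℚ)).Separable :=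
    PerfectField.separable_iff_squarefree.mpr hsq
  have hsepR : (p.map (Int.castRingHom ℝ)).Separable := by
    have := hsep.map (f := algebraMap ℚ ℝ)
    rwa [Polynomial.map_map, RingHom.ext_int ((algebraMap ℚ ℝ).comp _) (Int.castRingHom ℝ)] at this
  have hnd := nodup_roots hsepR
  set q := p.map (Int.castRingHom ℝ) with hq
  have hinjQ : Function.Injective (Int.castRingHom ℚ) := Int.cast_injective
  have hinjR : Function.Injective (Int.castRingHom ℝ) := Int.cast_injective
  -- The resultant of `p` and its derivative is an integer, nonzero because `p` is separable over
  -- `ℚ`; over `ℝ` it is the product of the derivative at the roots.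
  have h0 : resultant p (derivative p) p.natDegree (derivative p).natDegree ≠ 0 := by
    intro h0
    apply resultant_ne_zero _ _ hsep
    rw [derivative_map, resultant_map_map, natDegree_map_eq_of_injective hinjQ,
      natDegree_map_eq_of_injective hinjQ, h0, map_zero]
  have h1 := resultant_eq_prod_eval q (derivative q) (derivative p).natDegree
    (by rw [hq, derivative_map]; exact natDegree_map_le) hs
  rw [hq, derivative_map, resultant_map_map, natDegree_map_eq_of_injective hinjR, ← hq,
    (hp.map _).leadingCoeff, one_pow, one_mul, ← derivative_map, ← hq] at h1
  have h2 : (1 : ℝ) ≤ |(q.roots.map (derivative q).eval).prod| := by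
    rw [← h1]
    simp only [eq_intCast, ← Int.cast_abs]
    exact_mod_cast Int.one_le_abs h0
  refine h2.trans_eq ?_
  have h3 : (q.roots.map (derivative q).eval).prod =
      ∏ x ∈ q.roots.toFinset, (derivative q).eval x := by
    rw [Finset.prod_multiset_map_count]
    refine Finset.prod_congr rfl fun x hx => ?_
    rw [Multiset.count_eq_one_of_mem hnd (Multiset.mem_toFinset.mp hx), pow_one]
  rw [h3, Finset.abs_prod]
  refine Finset.prod_congr rfl fun x hx => ?_
  rw [hs.eval_root_derivative (hp.map _) (Multiset.mem_toFinset.mp hx), ← Finset.abs_prod]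
  congr 1
  rw [Finset.prod_eq_multiset_prod]
  congr 2
  rw [Finset.erase_val, Multiset.toFinset_val, hnd.dedup]

/-- A monic integral polynomial has a squarefree monic integral divisor with the same roots. -/
lemma exists_squarefree_dvd {f : ℤ[X]} (hf : f.Monic) :
    ∃ p : ℤ[X], p.Monic ∧ Squarefree (p.map (Int.castRingHom ℚ)) ∧ p ∣ f ∧
      ∀ x : ℝ, aeval x f = 0 → aeval x p = 0 := by
  set F := f.map (algebraMap ℤ ℚ) with hF
  have hF0 : F ≠ 0 := (hf.map _).ne_zero
  set R := UniqueFactorizationMonoid.radical F with hR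
  have hR0 : R ≠ 0 := UniqueFactorizationMonoid.radical_ne_zero
  -- Gauss's lemma: the radical over `ℚ` is, up to a constant, a monic integral polynomial.
  obtain ⟨p, hp⟩ := IsIntegrallyClosed.eq_map_mul_C_of_dvd ℚ hf
    (UniqueFactorizationMonoid.radical_dvd_self : R ∣ F)
  have hl : R.leadingCoeff ≠ 0 := leadingCoeff_ne_zero.mpr hR0
  have hu : IsUnit (C R.leadingCoeff) := isUnit_C.mpr hl.isUnit
  have hpm : p.Monic := by
    have h1 := congrArg leadingCoeff hp
    rw [leadingCoeff_mul, leadingCoeff_C] at h1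
    have h2 : (p.map (algebraMap ℤ ℚ)).Monic := mul_right_cancel₀ hl (h1.trans (one_mul _).symm)
    exact monic_of_injective (Int.cast_injective (α := ℚ)) h2
  have hass : Associated (p.map (algebraMap ℤ ℚ)) R := ⟨hu.unit, hp⟩
  refine ⟨p, hpm, ?_, ?_, fun x hx => ?_⟩
  · exact hass.squarefree_iff.mpr UniqueFactorizationMonoid.squarefree_radical
  · refine (Monic.dvd_iff_fraction_map_dvd_fraction_map (K := ℚ) hf hpm).mp ?_
    exact hass.dvd.trans UniqueFactorizationMonoid.radical_dvd_self
  · have hint : IsIntegral ℚ x := by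
      refine ⟨F, hf.map _, ?_⟩
      rw [← aeval_def, hF, aeval_map_algebraMap, hx]
    have hd : minpoly ℚ x ∣ F := minpoly.dvd ℚ x (by rw [hF, aeval_map_algebraMap, hx])
    have hd' : minpoly ℚ x ∣ R :=
      (UniqueFactorizationMonoid.dvd_radical_iff_of_irreducible (minpoly.irreducible hint) hF0).mpr
        hd
    have := hd'.trans hass.symm.dvd
    rw [← aeval_map_algebraMap ℚ]
    exact aeval_eq_zero_of_dvd_aeval_eq_zero this (minpoly.aeval ℚ x)

end Discriminant

/-! ### Distinct eigenvalues: discriminant and number -/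

section Spectrum

open Polynomial

variable {V : Type*} [Fintype V] [DecidableEq V] (G : SimpleGraph V) [DecidableRel G.Adj]

/-- The distinct eigenvalues of a graph have discriminant at least `1`. -/
lemma exists_finset_spectrum : ∃ S : Finset ℝ, (S : Set ℝ) = spectrum ℝ (G.adjMatrix ℝ) ∧
    1 ≤ ∏ x ∈ S, ∏ y ∈ S.erase x, |x - y| := by
  obtain ⟨p, hpm, hsq, hdvd, hroot⟩ := exists_squarefree_dvd (G.adjMatrix ℤ).charpoly_monic
  have hmap : (G.adjMatrix ℤ).charpoly.map (Int.castRingHom ℝ) = (G.adjMatrix ℝ).charpoly := by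
    rw [← Matrix.charpoly_map]
    congr 1
    ext i j
    simp [SimpleGraph.adjMatrix_apply, apply_ite]
  have hdvdR : p.map (Int.castRingHom ℝ) ∣ (G.adjMatrix ℝ).charpoly :=
    hmap ▸ Polynomial.map_dvd _ hdvd
  have hs : (p.map (Int.castRingHom ℝ)).Splits :=
    (G.isHermitian_adjMatrix ℝ).splits_charpoly.of_dvd (Matrix.charpoly_monic _).ne_zero hdvdR
  refine ⟨(p.map (Int.castRingHom ℝ)).roots.toFinset, ?_, one_le_prod_abs_sub_roots hpm hsq hs⟩
  ext x
  rw [Matrix.mem_spectrum_iff_isRoot_charpoly, Finset.mem_coe, Multiset.mem_toFinset,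
    mem_roots (hpm.map _).ne_zero]
  refine ⟨fun hx => hx.dvd hdvdR, fun hx => ?_⟩
  rw [← hmap, IsRoot, ← algebraMap_int_eq, eval_map_algebraMap] at hx
  rw [IsRoot, ← algebraMap_int_eq, eval_map_algebraMap]
  exact hroot x hx

/-- A connected regular graph with few distinct eigenvalues has few vertices. -/
lemma card_le_of_spectrum_eq {d : ℕ} (hG : G.IsRegularOfDegree d) (hc : G.Connected)
    {S : Finset ℝ} (hS : (S : Set ℝ) = spectrum ℝ (G.adjMatrix ℝ)) :
    Fintype.card V ≤ ∑ j ∈ Finset.range S.card, d ^ j := by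
  by_contra! hlt
  obtain ⟨u⟩ := hc.nonempty
  obtain ⟨v, hv⟩ := hG.exists_far u S.card hlt
  obtain ⟨w⟩ := hc.preconnected u v
  set A := G.adjMatrix ℝ with hA
  let P : ℝ[X] := ∏ x ∈ S, (X - C x)
  have hP : P.Monic := monic_prod_of_monic _ _ fun x _ => monic_X_sub_C x
  have hdeg : P.natDegree = S.card := by
    simp only [P]
    rw [natDegree_prod_of_monic _ _ fun x _ => monic_X_sub_C x]; simp
  have hherm : A.IsHermitian := G.isHermitian_adjMatrix ℝ
  have hPA : aeval A P = 0 := by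
    have hz : ∀ x ∈ spectrum ℝ A, P.eval x = 0 := fun x hx => by
      rw [← hS] at hx
      simp only [P, eval_prod]
      exact Finset.prod_eq_zero hx (by simp)
    rw [← cfc_polynomial P A hherm.isSelfAdjoint, cfc_congr (g := fun _ => 0) hz]
    simp
  -- As `P` annihilates the symmetric matrix `A`, every power of `A` is a combination of those with
  -- exponent below `S.card`. Their `(u, v)` entries count walks too short to reach `v`, whereas `w`
  -- is counted on the left.
  have hpow : A ^ w.length = ∑ j ∈ Finset.range S.card,
      (X ^ w.length %ₘ P : ℝ[X]).coeff j • A ^ j := by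
    have h1 : aeval A (X ^ w.length %ₘ P : ℝ[X]) = A ^ w.length := by
      rw [aeval_modByMonic_eq_self_of_root hPA]; simp
    rw [← h1, aeval_eq_sum_range']
    by_cases hP1 : P = 1
    · rw [hP1] at hdeg
      have : (1 : Matrix V V ℝ) = 0 := by simpa [hP1] using hPA
      exact absurd (congrFun (congrFun this u) u) (by simp)
    · rw [← hdeg]; exact natDegree_modByMonic_lt _ hP hP1
  have h2 := congrFun (congrFun hpow u) v
  rw [Matrix.sum_apply, Finset.sum_eq_zero, hA, SimpleGraph.adjMatrix_pow_apply_eq_card_walk] at h2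
  · have h3 : Fintype.card {p : G.Walk u v | p.length = w.length} = 0 := by exact_mod_cast h2
    exact (Fintype.card_eq_zero_iff.mp h3).false ⟨w, rfl⟩
  · intro j hj
    rw [Matrix.smul_apply, hA, SimpleGraph.adjMatrix_pow_apply_eq_card_walk]
    have : Fintype.card {p : G.Walk u v | p.length = j} = 0 :=
      Fintype.card_eq_zero_iff.mpr ⟨fun q => by
        have h4 : q.1.length = j := q.2
        have := hv q.1
        have := Finset.mem_range.mp hj
        omega⟩
    simp [this]

end Spectrum

lemma IsSpectralSet.exists_finset {K : Set ℝ} (hK : IsSpectralSet K) (N : ℕ) :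
    ∃ S : Finset ℝ, (S : Set ℝ) ⊆ K ∧ N ≤ S.card ∧ 1 ≤ ∏ x ∈ S, ∏ y ∈ S.erase x, |x - y| := by
  obtain ⟨n, hn, G, ⟨hconn, hreg⟩, hG⟩ := hK.2.2 ((∑ j ∈ Finset.range N, 3 ^ j) + 1)
  classical
  obtain ⟨S, hS, h1⟩ := exists_finset_spectrum G
  refine ⟨S, ?_, ?_, h1⟩
  · refine hS.subset.trans fun x hx => hG ?_
    rw [adjSpectrum]
    convert hx
  · by_contra! hlt
    have h2 := card_le_of_spectrum_eq G (d := 3) (by convert hreg) hconn hS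
    have h3 : ∑ j ∈ Finset.range S.card, 3 ^ j ≤ ∑ j ∈ Finset.range N, 3 ^ j :=
      Finset.sum_le_sum_of_subset (Finset.range_mono hlt.le)
    rw [Fintype.card_fin] at h2
    omega

/-! ### Logarithmic energy and weak limits -/

section Capacity

open MeasureTheory Filter Topology

/-- The logarithmic kernel cut off at height `M`. -/
noncomputable def truncLogKernel (M : ℕ) (z w : ℂ) : ℝ := -Real.log (max (dist z w) (Real.exp (-M)))

lemma continuous_truncLogKernel (M : ℕ) :
    Continuous fun z : ℂ × ℂ => truncLogKernel M z.1 z.2 := by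
  refine (Continuous.log (by fun_prop) fun z => ?_).neg
  exact (lt_max_of_lt_right (Real.exp_pos _)).ne'

lemma truncLogKernel_le (M : ℕ) (z w : ℂ) : truncLogKernel M z w ≤ M := by
  rw [truncLogKernel, neg_le, Real.le_log_iff_exp_le (lt_max_of_lt_right (Real.exp_pos _))]
  exact le_max_right _ _

lemma truncLogKernel_le_neg_log (M : ℕ) {z w : ℂ} (h : z ≠ w) :
    truncLogKernel M z w ≤ -Real.log (dist z w) :=
  neg_le_neg (Real.log_le_log (dist_pos.mpr h) (le_max_left _ _))

lemma monotone_truncLogKernel (z w : ℂ) : Monotone fun M => truncLogKernel M z w := by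
  intro M M' h
  refine neg_le_neg (Real.log_le_log (lt_max_of_lt_right (Real.exp_pos _)) ?_)
  gcongr

lemma logKernel_of_ne {z w : ℂ} (h : z ≠ w) : logKernel z w = ((-Real.log (dist z w) : ℝ) : EReal) := by
  rw [logKernel, edist_dist, ENNReal.log_ofReal_of_pos (dist_pos.mpr h)]
  simp

lemma toENNReal_logKernel (z w : ℂ) :
    (logKernel z w).toENNReal = ⨆ M : ℕ, ENNReal.ofReal (truncLogKernel M z w) := by
  by_cases h : z = w
  · subst h
    have : ∀ M : ℕ, truncLogKernel M z z = M := fun M => by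
      rw [truncLogKernel, dist_self, max_eq_right (Real.exp_pos _).le, Real.log_exp, neg_neg]
    simp [logKernel, this, ENNReal.iSup_natCast]
  · rw [logKernel_of_ne h, EReal.toENNReal_of_ne_top (EReal.coe_ne_top _), EReal.toReal_coe]
    refine le_antisymm ?_ (iSup_le fun M => ENNReal.ofReal_le_ofReal (truncLogKernel_le_neg_log M h))
    obtain ⟨M, hM⟩ := exists_nat_ge (-Real.log (dist z w))
    refine le_iSup_of_le M (ENNReal.ofReal_le_ofReal ?_)
    rw [truncLogKernel, max_eq_left]
    rw [← Real.le_log_iff_exp_le (dist_pos.mpr h)]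
    linarith

/-- The cutoff acts only at distances below `exp (-M) ≤ 1`, where the kernel is nonnegative, so the
negative part does not depend on `M`. -/
lemma toENNReal_neg_logKernel (M : ℕ) (z w : ℂ) :
    (-logKernel z w).toENNReal = ENNReal.ofReal (-truncLogKernel M z w) := by
  have hM : Real.exp (-M) ≤ 1 := Real.exp_le_one_iff.mpr (by simp)
  by_cases h : z = w
  · subst h
    rw [truncLogKernel, dist_self, max_eq_right (Real.exp_pos _).le, Real.log_exp]
    simp [logKernel]
  · rw [logKernel_of_ne h, ← EReal.coe_neg, EReal.toENNReal_of_ne_top (EReal.coe_ne_top _),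
      EReal.toReal_coe, truncLogKernel, neg_neg, neg_neg]
    rcases le_total (dist z w) (Real.exp (-M)) with h1 | h1
    · rw [max_eq_right h1, ENNReal.ofReal_of_nonpos, ENNReal.ofReal_of_nonpos]
      · rw [Real.log_exp]; simp
      · exact Real.log_nonpos dist_nonneg (h1.trans hM)
    · rw [max_eq_left h1]

/-- The uniform probability measure on a nonempty finite set. -/
noncomputable def uniformMeasure {X : Type*} [MeasurableSpace X] (S : Finset X) : Measure X :=
  (S.card : ℝ≥0∞)⁻¹ • ∑ x ∈ S, Measure.dirac x

lemma isProbabilityMeasure_uniformMeasure {X : Type*} [MeasurableSpace X] {S : Finset X}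
    (hS : S.Nonempty) : IsProbabilityMeasure (uniformMeasure S) := by
  refine ⟨?_⟩
  simp only [uniformMeasure, Measure.smul_apply, Measure.finsetSum_apply, measure_univ,
    Finset.sum_const, nsmul_eq_mul, mul_one, smul_eq_mul]
  exact ENNReal.inv_mul_cancel (by simpa using hS.ne_empty) (by simp)

lemma integral_uniformMeasure {X : Type*} [MeasurableSpace X] [MeasurableSingletonClass X]
    (S : Finset X) (f : X → ℝ) :
    ∫ x, f x ∂uniformMeasure S = (S.card : ℝ)⁻¹ * ∑ x ∈ S, f x := by
  rw [uniformMeasure, integral_smul_measure, integral_finsetSum_measure]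
  · simp
  · intro x _
    exact integrable_dirac (by simp)

section Compact

variable {E : Set ℂ} [CompactSpace E]

/-- With `n` points, each diagonal term is at most `M`, and the off-diagonal terms sum to at most
minus the logarithm of the discriminant, hence to at most 0. The total `n M` is divided by `n ^ 2`.
-/
lemma integral_truncLogKernel_uniformMeasure_le (M : ℕ) {S : Finset E} (hS : S.Nonempty)
    (hd : 1 ≤ ∏ x ∈ S, ∏ y ∈ S.erase x, dist x y) :
    ∫ z : E × E, truncLogKernel M z.1 z.2 ∂(uniformMeasure S).prod (uniformMeasure S) ≤ M / S.card := by
  have := isProbabilityMeasure_uniformMeasure hS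
  have hcont : Continuous fun z : E × E => truncLogKernel M z.1 z.2 :=
    (continuous_truncLogKernel M).comp (continuous_subtype_val.prodMap continuous_subtype_val)
  rw [integral_prod _ (hcont.integrable_of_hasCompactSupport (HasCompactSupport.of_compactSpace _))]
  simp only [integral_uniformMeasure]
  have hpos : (0 : ℝ) < S.card := by exact_mod_cast hS.card_pos
  have hpair : ∀ x ∈ S, ∀ y ∈ S.erase x, dist x y ≠ 0 := fun x _ y hy =>
    dist_ne_zero.mpr (Finset.ne_of_mem_erase hy).symm
  have hlog : 0 ≤ ∑ x ∈ S, ∑ y ∈ S.erase x, Real.log (dist x y) := by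
    have h1 := Real.log_nonneg hd
    rw [Real.log_prod fun x hx => Finset.prod_ne_zero_iff.mpr (hpair x hx)] at h1
    rwa [Finset.sum_congr rfl fun x hx => Real.log_prod (hpair x hx)] at h1
  have hsum : ∑ x ∈ S, ∑ y ∈ S, truncLogKernel M x y ≤ S.card * M := by
    calc ∑ x ∈ S, ∑ y ∈ S, truncLogKernel M x y
        ≤ ∑ x ∈ S, ((M : ℝ) - ∑ y ∈ S.erase x, Real.log (dist x y)) := by
          refine Finset.sum_le_sum fun x hx => ?_
          rw [← Finset.add_sum_erase _ _ hx, sub_eq_add_neg, ← Finset.sum_neg_distrib]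
          refine add_le_add (truncLogKernel_le _ _ _) (Finset.sum_le_sum fun y hy => ?_)
          exact truncLogKernel_le_neg_log M fun hh =>
            (Finset.ne_of_mem_erase hy) (Subtype.ext hh).symm
      _ ≤ S.card * M := by
          rw [Finset.sum_sub_distrib]; simp; linarith
  rw [← Finset.mul_sum, ← mul_assoc, ← mul_inv, inv_mul_eq_div, div_le_div_iff₀ (by positivity) hpos]
  nlinarith

/-- The probability measures on a compact space are weakly compact. The truncated energy is weakly
continuous, so a cluster point of the uniform measures inherits the bounds `M / n → 0` for every `M`
at once. -/
lemma exists_measure_integral_truncLogKernel_nonpos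
    (hE : ∀ N : ℕ, ∃ S : Finset E, N ≤ S.card ∧ 1 ≤ ∏ x ∈ S, ∏ y ∈ S.erase x, dist x y) :
    ∃ μ : ProbabilityMeasure E, ∀ M : ℕ,
      ∫ z : E × E, truncLogKernel M z.1 z.2 ∂((μ : Measure E).prod μ) ≤ 0 := by
  choose S hS hd using fun N => hE (N + 1)
  have hne : ∀ N, (S N).Nonempty := fun N => Finset.card_pos.mp (by have := hS N; omega)
  let ν : ℕ → ProbabilityMeasure E := fun N =>
    ⟨uniformMeasure (S N), isProbabilityMeasure_uniformMeasure (hne N)⟩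
  obtain ⟨μ, hμ⟩ := exists_clusterPt_of_compactSpace (map ν atTop)
  refine ⟨μ, fun M => le_of_forall_pos_le_add fun ε hε => ?_⟩
  rw [zero_add]
  let φ : C(E × E, ℝ) := ⟨fun z => truncLogKernel M z.1 z.2,
    (continuous_truncLogKernel M).comp (continuous_subtype_val.prodMap continuous_subtype_val)⟩
  have hc : Continuous fun κ : ProbabilityMeasure E =>
      ∫ z, BoundedContinuousFunction.mkOfCompact φ z ∂(κ.prod κ : Measure (E × E)) :=
    (ProbabilityMeasure.continuous_integral_boundedContinuousFunction _).comp
      (ProbabilityMeasure.continuous_prod.comp (continuous_id.prodMk continuous_id))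
  have hclosed : IsClosed {κ : ProbabilityMeasure E |
      ∫ z, BoundedContinuousFunction.mkOfCompact φ z ∂(κ.prod κ : Measure (E × E)) ≤ ε} :=
    isClosed_le hc continuous_const
  have hmem : {κ : ProbabilityMeasure E |
      ∫ z, BoundedContinuousFunction.mkOfCompact φ z ∂(κ.prod κ : Measure (E × E)) ≤ ε} ∈
      map ν atTop := by
    obtain ⟨N, hN⟩ := exists_nat_gt (M / ε)
    refine mem_map.mpr (mem_atTop_sets.mpr ⟨N, fun n hn => ?_⟩)
    refine (integral_truncLogKernel_uniformMeasure_le M (hne n) (hd n)).trans ?_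
    have h1 : (N : ℝ) ≤ (S n).card := by
      have := hS n
      exact_mod_cast (by omega : N ≤ (S n).card)
    have h2 : M / ε < (S n).card := hN.trans_le h1
    rw [div_lt_iff₀ hε] at h2
    rw [div_le_iff₀ (by exact_mod_cast (hne n).card_pos)]
    linarith
  have h3 : μ ∈ closure {κ : ProbabilityMeasure E |
      ∫ z, BoundedContinuousFunction.mkOfCompact φ z ∂(κ.prod κ : Measure (E × E)) ≤ ε} :=
    mem_closure_iff_clusterPt.mpr (hμ.mono (le_principal_iff.mpr hmem))
  exact hclosed.closure_subset h3

/-- Monotone convergence in `M` for the positive parts; the negative parts are the same finite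
integral for all `M`. -/
lemma lintegral_logKernel_le {μ : Measure E} [IsProbabilityMeasure μ]
    (hμ : ∀ M : ℕ, ∫ z : E × E, truncLogKernel M z.1 z.2 ∂(μ.prod μ) ≤ 0) :
    ∫⁻ z : E, ∫⁻ w : E, (logKernel z w).toENNReal ∂μ ∂μ ≤
      ∫⁻ z : E, ∫⁻ w : E, (-logKernel z w).toENNReal ∂μ ∂μ := by
  have hcont : ∀ M, Continuous fun z : E × E => truncLogKernel M z.1 z.2 := fun M =>
    (continuous_truncLogKernel M).comp (continuous_subtype_val.prodMap continuous_subtype_val)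
  have hm : ∀ M, Measurable fun z : E × E => ENNReal.ofReal (truncLogKernel M z.1 z.2) := fun M =>
    (hcont M).measurable.ennreal_ofReal
  simp only [toENNReal_logKernel, toENNReal_neg_logKernel 0]
  rw [← lintegral_prod (μ := μ) (ν := μ)
      (fun z : E × E => ⨆ M : ℕ, ENNReal.ofReal (truncLogKernel M z.1 z.2))
      (Measurable.iSup hm).aemeasurable,
    ← lintegral_prod (μ := μ) (ν := μ) (fun z : E × E => ENNReal.ofReal (-truncLogKernel 0 z.1 z.2))
      (hcont 0).measurable.neg.ennreal_ofReal.aemeasurable,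
    lintegral_iSup hm fun M M' h z => ENNReal.ofReal_le_ofReal (monotone_truncLogKernel _ _ h)]
  refine iSup_le fun M => ?_
  have hint : Integrable (fun z : E × E => truncLogKernel M z.1 z.2) (μ.prod μ) :=
    (hcont M).integrable_of_hasCompactSupport (HasCompactSupport.of_compactSpace _)
  have h1 := hμ M
  rw [integral_eq_lintegral_pos_part_sub_lintegral_neg_part hint, sub_nonpos] at h1
  refine ((ENNReal.toReal_le_toReal hint.lintegral_lt_top.ne
    hint.neg.lintegral_lt_top.ne).mp h1).trans_eq (lintegral_congr fun z => ?_)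
  exact (toENNReal_neg_logKernel M _ _).symm.trans (toENNReal_neg_logKernel 0 _ _)

end Compact

/-- A compact set that contains arbitrarily large finite sets with discriminant at least `1` has
capacity at least `1`. -/
theorem one_le_logCapacity {E : Set ℂ} (hE : IsCompact E)
    (h : ∀ N : ℕ, ∃ S : Finset E, N ≤ S.card ∧ 1 ≤ ∏ x ∈ S, ∏ y ∈ S.erase x, dist x y) :
    1 ≤ logCapacity E := by
  have : CompactSpace E := isCompact_iff_compactSpace.mp hE
  obtain ⟨μ, hμ⟩ := exists_measure_integral_truncLogKernel_nonpos h
  have hemb : MeasurableEmbedding (Subtype.val : E → ℂ) :=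
    MeasurableEmbedding.subtype_coe hE.measurableSet
  have hprob : IsProbabilityMeasure ((μ : Measure E).map Subtype.val) :=
    Measure.isProbabilityMeasure_map hemb.measurable.aemeasurable
  refine le_iSup_of_le ((μ : Measure E).map Subtype.val) (le_iSup_of_le hprob
    (le_iSup_of_le ⟨E, hE, le_rfl, ?_⟩ ?_))
  · rw [hemb.map_apply]; simp
  · have hle : logEnergy ((μ : Measure E).map Subtype.val) ≤ 0 := by
      rw [logEnergy]
      simp only [hemb.lintegral_map]
      have := lintegral_logKernel_le hμ
      refine EReal.sub_nonpos.mpr ?_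
      exact_mod_cast this
    rw [← EReal.exp_zero]
    exact EReal.exp_monotone (by simpa using EReal.neg_le_neg_iff.mpr hle)

end Capacity

theorem theorem2 (K : Set ℝ) (hK : IsSpectralSet K) :
    1 ≤ logCapacity (Complex.ofReal '' K) ∧
    ∀ I : Set ℝ, I.OrdConnected →
      I ⊆ Set.Ioo (-1 - Real.sqrt 2) (1 + Real.sqrt 2) → 2 < Metric.diam I →
      (I ∩ K).Nonempty := by
  refine ⟨one_le_logCapacity ?_ fun N => ?_, fun I hI hsub hd => hK.inter_nonempty hI hsub hd⟩
  · exact (isCompact_Icc.of_isClosed_subset hK.1 hK.2.1).image Complex.continuous_ofReal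
  · obtain ⟨S, hS, hN, h1⟩ := hK.exists_finset N
    classical
    let ι : S ↪ (Complex.ofReal '' K) :=
      ⟨fun x => ⟨(x : ℝ), x, hS x.2, rfl⟩, fun x y hxy => by
        have := congrArg Subtype.val hxy
        exact Subtype.ext (Complex.ofReal_injective this)⟩
    refine ⟨S.attach.map ι, by simpa using hN, h1.trans_eq ?_⟩
    rw [Finset.prod_map, ← Finset.prod_attach]
    refine Finset.prod_congr rfl fun x _ => ?_
    rw [← Finset.map_erase, Finset.prod_map]
    refine Finset.prod_bij' (fun y hy => ⟨y, Finset.mem_of_mem_erase hy⟩) (fun y _ => (y : ℝ))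
      (fun y hy => ?_) (fun y hy => ?_) (fun y hy => rfl) (fun y hy => rfl) (fun y hy => ?_)
    · exact Finset.mem_erase.mpr ⟨fun h => Finset.ne_of_mem_erase hy (congrArg Subtype.val h),
        Finset.mem_attach _ _⟩
    · exact Finset.mem_erase.mpr ⟨fun h => Finset.ne_of_mem_erase hy (Subtype.ext h), y.2⟩
    · rw [Subtype.dist_eq, Complex.dist_eq]
      exact (((congrArg norm (Complex.ofReal_sub (x : ℝ) y)).symm.trans (Complex.norm_real _))).symm
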